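/- **Setting.** $TO$ is the theory of total orders $\le$ with a constant $0$ (sort INDEX); $i<j$ means $i\le j\wedge i\ne j$. $\mathcal{ARD}$ is the theory with sorts ARRAY, ELEM, INDEX, the symbols of $TO$, operations $rd$, $wr$, $\mathrm{diff}:\mathrm{ARRAY}\times\mathrm{ARRAY}\to\mathrm{INDEX}$, and constants $\varepsilon$ (array), $\bot$ (element), axiomatized by $TO$ and $i\ge 0\to rd(wr(y,i,e),i)=e$; $\ i\ne j\to rd(wr(y,i,e),j)=rd(y,j)$; $\ x\ne y\to rd(x,\mathrm{diff}(x,y))\ne rd(y,\mathrm{diff}(x,y))$; $\ i>\mathrm{diff}(x,y)\to rd(x,i)=rd(y,i)$; $\ \mathrm{diff}(x,x)=0$; $\ i<0\to rd(x,i)=\bot$; $\ rd(\varepsilon,i)=\bot$. Iterated diffs are $\mathrm{diff}_k(a,b)=\mathrm{diff}(a,b_k)$, where $b_1=b$ and $b_{k+1}=wr(b_k,\mathrm{diff}_k(a,b),rd(a,\mathrm{diff}_k(a,b)))$. A *separated pair* $\Phi=(\Phi_1,\Phi_2)$ consists of a set $\Phi_1$ of equalities $\mathrm{diff}_k(a,b)=i$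 and $a=wr(b,i,e)$ such that, if $\mathrm{diff}_k(a,b)=i$ is in $\Phi_1$, then for every $1\le l<k$ some $\mathrm{diff}_l(a,b)=j$ is in $\Phi_1$, and of a set $\Phi_2$ of Boolean combinations of atoms $i=j$, $i\le j$, $rd(a,i)=rd(b,j)$, $rd(a,i)=e$, $e_1=e_2$. Here $a,b,i,j,e,e_1,e_2$ are variables or constants ($\varepsilon$, $0$, $\bot$) of the appropriate sorts. Its *instantiation* is obtained by adding to $\Phi_2$, for all $t$ that are $0$ or an index variable occurring in $\Phi$: (a) $rd(\varepsilon,t)=\bot$, and $t<0\to rd(a,t)=\bot$ for every array variable $a$ occurring in $\Phi$; (b) for every $a=wr(b,i,e)$ in $\Phi_1$, the formulae $i\ge0\to rd(a,i)=e$ and $t\ne i\to rd(a,t)=rd(b,t)$; (c) whenever $l\ge1$ and $\mathrm{diff}_1(a,b)=k_1,\dots,\mathrm{diff}_l(a,b)=k_l$ are in $\Phi_1$, the formulae $k_1\ge\cdots\ge k_l\ge0$; $\bigwedge_{j<l}(k_j>k_{j+1}\to rd(a,k_j)\ne rd(b,k_j))$; $\bigwedge_{j<l}(k_j=k_{j+1}\to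 k_j=0)$; $\bigwedge_{j\le l}(rd(a,k_j)=rd(b,k_j)\to k_j=0)$; and $t>k_l\to rd(a,t)=rd(b,t)\vee t=k_1\vee\cdots\vee t=k_{l-1}$. The pair is *0-instantiated* if it equals its instantiation. Let $A=(A_1,A_2)$, $B=(B_1,B_2)$ be finite 0-instantiated separated pairs. $A_2\wedge B_2$ is regarded as a formula of $TO\cup\mathcal{EUF}$ by reading $rd(a,i)$ as $f_a(i)$ with $f_a$ a free function symbol, and variables as free constants. The *common array variables* are the array variables occurring both in $A$ and in $B$, together with the constant $\varepsilon$ in case it occurs in an equality of $A_1\cup B_1$. **Loop**, repeated until $A_2\wedge B_2$ becomes inconsistent modulo $TO\cup\mathcal{EUF}$: pick two distinct common array variables $c_1,c_2$ and the $n'\ge1$ such that no equality $\mathrm{diff}_{n'}(c_1,c_2)=k$ belongs to both $A_1$ and $B_1$, while for every $1\le l<n'$ some equality $\mathrm{diff}_l(c_1,c_2)=k$ belongs to both; pick a fresh index variable $k_{n'}$, add $\mathrm{diff}_{n'}(c_1,c_2)=k_{n'}$ to both $A_1$ and $B_1$, and replace both $A$ and $B$ by their instantiations. The loop is executed *fairly*: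 each unordered pair of distinct common array variables is always handled in the same order $(c_1,c_2)$, and at every moment the numbers of times that any two unordered pairs have been handled differ by at most $1$. **Theorem.** If $A\wedge B$ (the conjunction of all formulae in $A_1,A_2,B_1,B_2$) is inconsistent modulo $\mathcal{ARD}$, then every fair execution of the loop terminates, with $A_2\wedge B_2$ inconsistent modulo $TO\cup\mathcal{EUF}$, after at most $$\frac{m^2-m}{2}\cdot(n+1)$$ steps, where $n$ is the number of index variables occurring in (the initial) $A,B$ and $m$ is the number of common array variables. -/

import Mathlib

/-! # Arrays with maxdiff over total orders, and the interpolation loop -/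

namespace MaxDiff

/-! ## Syntax -/

/-- Index terms of the language of total orders with `0`: an index variable or `0`.
There are no function symbols, so every index term has complexity `0`. -/
inductive IdxTerm where
  | var (x : ℕ)
  | zero
  deriving DecidableEq

/-- A variable of sort element, or the constant `⊥`. -/
inductive ElTerm where
  | var (x : ℕ)
  | bot
  deriving DecidableEq

/-- A variable of sort array, or the constant `ε`. -/
inductive ArrTerm where
  | var (x : ℕ)
  | eps
  deriving DecidableEq

/-- Boolean combinations of atoms `s = t`, `s ≤ t` (index terms), `rd(a,i) = rd(b,j)`,
`rd(a,i) = e` and `e₁ = e₂`. -/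
inductive Fml where
  | idxEq (s t : IdxTerm)
  | idxLe (s t : IdxTerm)
  | rdEqRd (a : ArrTerm) (i : IdxTerm) (b : ArrTerm) (j : IdxTerm)
  | rdEq (a : ArrTerm) (i : IdxTerm) (e : ElTerm)
  | elEq (e₁ e₂ : ElTerm)
  | tru
  | neg (φ : Fml)
  | and (φ ψ : Fml)

namespace Fml

def or (φ ψ : Fml) : Fml := neg (and (neg φ) (neg ψ))

def imp (φ ψ : Fml) : Fml := or (neg φ) ψ

/-- `s < t` abbreviates `s ≤ t ∧ s ≠ t`. -/
def idxLt (s t : IdxTerm) : Fml := and (idxLe s t) (neg (idxEq s t))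

def bigAnd : List Fml → Fml
  | [] => tru
  | φ :: l => and φ (bigAnd l)

def bigOr : List Fml → Fml
  | [] => neg tru
  | φ :: l => or φ (bigOr l)

end Fml

/-- The equalities allowed in the first component of a separated pair.
`diff k a b i` stands for `diff_{k+1}(a,b) = i` (iterated diffs are counted from `0` here),
`wr a b i e` stands for `a = wr(b,i,e)`. -/
inductive DefAtom where
  | diff (k : ℕ) (a b : ArrTerm) (i : IdxTerm)
  | wr (a b : ArrTerm) (i : IdxTerm) (e : ElTerm)

/-! ## Occurrences of symbols -/

def IdxTerm.vars : IdxTerm → Set ℕ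
  | .var x => {x}
  | .zero => ∅

/-- The index variables occurring in a formula. -/
def Fml.idxVars : Fml → Set ℕ
  | .idxEq s t => s.vars ∪ t.vars
  | .idxLe s t => s.vars ∪ t.vars
  | .rdEqRd _ i _ j => i.vars ∪ j.vars
  | .rdEq _ i _ => i.vars
  | .elEq _ _ => ∅
  | .tru => ∅
  | .neg φ => φ.idxVars
  | .and φ ψ => φ.idxVars ∪ ψ.idxVars

/-- The array variables and array constants occurring in a formula. -/
def Fml.arrs : Fml → Set ArrTerm
  | .idxEq _ _ => ∅
  | .idxLe _ _ => ∅
  | .rdEqRd a _ b _ => {a, b}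
  | .rdEq a _ _ => {a}
  | .elEq _ _ => ∅
  | .tru => ∅
  | .neg φ => φ.arrs
  | .and φ ψ => φ.arrs ∪ ψ.arrs

def DefAtom.idxVars : DefAtom → Set ℕ
  | .diff _ _ _ i => i.vars
  | .wr _ _ i _ => i.vars

def DefAtom.arrs : DefAtom → Set ArrTerm
  | .diff _ a b _ => {a, b}
  | .wr a b _ _ => {a, b}

/-! ## Separated pairs and instantiation -/

/-- A pair `Φ = (Φ₁, Φ₂)` of sets of formulae of the two allowed shapes. -/
@[ext]
structure FmlPair where
  defs : Set DefAtom
  fmls : Set Fml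

namespace FmlPair

/-- If `diff_k(a,b) = i` is in `Φ₁`, then for every `l < k` some `diff_l(a,b) = j` is in `Φ₁`. -/
def IsSeparated (Φ : FmlPair) : Prop :=
  ∀ k a b i, DefAtom.diff k a b i ∈ Φ.defs → ∀ l < k, ∃ j, DefAtom.diff l a b j ∈ Φ.defs

def IsFinite (Φ : FmlPair) : Prop := Φ.defs.Finite ∧ Φ.fmls.Finite

/-- The index variables occurring in the pair. -/
def idxVars (Φ : FmlPair) : Set ℕ :=
  (⋃ α ∈ Φ.defs, α.idxVars) ∪ ⋃ φ ∈ Φ.fmls, φ.idxVars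

/-- The array variables occurring in the pair. -/
def arrVars (Φ : FmlPair) : Set ℕ :=
  {x | (∃ α ∈ Φ.defs, ArrTerm.var x ∈ α.arrs) ∨ ∃ φ ∈ Φ.fmls, ArrTerm.var x ∈ φ.arrs}

/-- The index terms built up from the index variables occurring in the pair.  For total orders all
of them have complexity `0`, so this is the set of instantiating terms of the `N`-instantiation for
every `N`. -/
def instTerms (Φ : FmlPair) : Set IdxTerm := {t | t.vars ⊆ Φ.idxVars}

/-- `diff_1(a,b) = k_1, …, diff_l(a,b) = k_l` all belong to `Φ₁`, where
`ks = [k_1, …, k_l]` and `l ≥ 1`. -/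
def HasDiffs (Φ : FmlPair) (a b : ArrTerm) (ks : List IdxTerm) : Prop :=
  ks ≠ [] ∧ ∀ (j : ℕ) (h : j < ks.length), DefAtom.diff j a b ks[j] ∈ Φ.defs

end FmlPair

open Fml in
/-- `i ≥ 0 → rd(a,i) = e` (the ground part of the clauses equivalent to `a = wr(b,i,e)`). -/
def wrGround (a : ArrTerm) (i : IdxTerm) (e : ElTerm) : Fml :=
  imp (idxLe .zero i) (rdEq a i e)

open Fml in
/-- `t ≠ i → rd(a,t) = rd(b,t)`. -/
def wrInst (a b : ArrTerm) (i t : IdxTerm) : Fml :=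
  imp (neg (idxEq t i)) (rdEqRd a t b t)

open Fml in
/-- `k_1 ≥ k_2 ∧ ⋯ ∧ k_{l-1} ≥ k_l ∧ k_l ≥ 0`. -/
def diffMono : List IdxTerm → Fml
  | [] => tru
  | [k] => idxLe .zero k
  | k :: k' :: ks => and (idxLe k' k) (diffMono (k' :: ks))

open Fml in
/-- `⋀_{j<l} (k_j > k_{j+1} → rd(a,k_j) ≠ rd(b,k_j))`. -/
def diffNe (a b : ArrTerm) : List IdxTerm → Fml
  | [] => tru
  | [_] => tru
  | k :: k' :: ks => and (imp (idxLt k' k) (neg (rdEqRd a k b k))) (diffNe a b (k' :: ks))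

open Fml in
/-- `⋀_{j<l} (k_j = k_{j+1} → k_j = 0)`. -/
def diffRepeat : List IdxTerm → Fml
  | [] => tru
  | [_] => tru
  | k :: k' :: ks => and (imp (idxEq k k') (idxEq k .zero)) (diffRepeat (k' :: ks))

open Fml in
/-- `⋀_{j≤l} (rd(a,k_j) = rd(b,k_j) → k_j = 0)`. -/
def diffZero (a b : ArrTerm) (ks : List IdxTerm) : Fml :=
  bigAnd (ks.map fun k => imp (rdEqRd a k b k) (idxEq k .zero))

open Fml in
/-- `t > k_l → rd(a,t) = rd(b,t) ∨ t = k_1 ∨ ⋯ ∨ t = k_{l-1}`,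
where `js = [k_1, …, k_{l-1}]` and `k = k_l`. -/
def diffInst (a b : ArrTerm) (js : List IdxTerm) (k t : IdxTerm) : Fml :=
  imp (idxLt k t) (or (rdEqRd a t b t) (bigOr (js.map fun j => idxEq t j)))

/-- The formulae that the instantiation of `Φ` adds to `Φ₂`. -/
inductive FmlPair.Added (Φ : FmlPair) : Fml → Prop
  | eps (t : IdxTerm) (ht : t ∈ Φ.instTerms) :
      Added Φ (.rdEq .eps t .bot)
  | neg (x : ℕ) (hx : x ∈ Φ.arrVars) (t : IdxTerm) (ht : t ∈ Φ.instTerms) :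
      Added Φ (.imp (.idxLt t .zero) (.rdEq (.var x) t .bot))
  | wrGround (a b : ArrTerm) (i : IdxTerm) (e : ElTerm) (h : DefAtom.wr a b i e ∈ Φ.defs) :
      Added Φ (wrGround a i e)
  | wrInst (a b : ArrTerm) (i : IdxTerm) (e : ElTerm) (h : DefAtom.wr a b i e ∈ Φ.defs)
      (t : IdxTerm) (ht : t ∈ Φ.instTerms) :
      Added Φ (wrInst a b i t)
  | diffMono (a b : ArrTerm) (ks : List IdxTerm) (h : Φ.HasDiffs a b ks) :
      Added Φ (diffMono ks)
  | diffNe (a b : ArrTerm) (ks : List IdxTerm) (h : Φ.HasDiffs a b ks) :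
      Added Φ (diffNe a b ks)
  | diffRepeat (a b : ArrTerm) (ks : List IdxTerm) (h : Φ.HasDiffs a b ks) :
      Added Φ (diffRepeat ks)
  | diffZero (a b : ArrTerm) (ks : List IdxTerm) (h : Φ.HasDiffs a b ks) :
      Added Φ (diffZero a b ks)
  | diffInst (a b : ArrTerm) (js : List IdxTerm) (k : IdxTerm) (h : Φ.HasDiffs a b (js ++ [k]))
      (t : IdxTerm) (ht : t ∈ Φ.instTerms) :
      Added Φ (diffInst a b js k t)

/-- The `N`-instantiation of a pair (the same for all `N`, as the index theory is that of total
orders). -/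
def FmlPair.instantiate (Φ : FmlPair) : FmlPair where
  defs := Φ.defs
  fmls := Φ.fmls ∪ {φ | Φ.Added φ}

/-- The pair is `0`-instantiated. -/
def FmlPair.IsInstantiated (Φ : FmlPair) : Prop := Φ.instantiate = Φ

/-! ## Semantics -/

/-- A model of the union of the theory of total orders with `0` and of the theory of equality with
uninterpreted functions, for formulae in which `rd(a,i)` is read as `f_a(i)` with `f_a` a free
function symbol (also for `a = ε`), `⊥` is a free constant, and the index and element variables are
free constants. -/
structure ToEufModel where
  Index : Type
  Elem : Type
  [order : LinearOrder Index]
  zero : Index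
  bot : Elem
  func : ArrTerm → Index → Elem
  idxVal : ℕ → Index
  elVal : ℕ → Elem

attribute [instance] ToEufModel.order

namespace ToEufModel

variable (M : ToEufModel)

def idx : IdxTerm → M.Index
  | .var x => M.idxVal x
  | .zero => M.zero

def el : ElTerm → M.Elem
  | .var x => M.elVal x
  | .bot => M.bot

def Holds : Fml → Prop
  | .idxEq s t => M.idx s = M.idx t
  | .idxLe s t => M.idx s ≤ M.idx t
  | .rdEqRd a i b j => M.func a (M.idx i) = M.func b (M.idx j)
  | .rdEq a i e => M.func a (M.idx i) = M.el e
  | .elEq e₁ e₂ => M.el e₁ = M.el e₂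
  | .tru => True
  | .neg φ => ¬ Holds φ
  | .and φ ψ => Holds φ ∧ Holds ψ

end ToEufModel

/-- `A₂ ∧ B₂` is consistent modulo `TO ∪ EUF`. -/
def ToEufConsistent (A B : FmlPair) : Prop :=
  ∃ M : ToEufModel, ∀ φ ∈ A.fmls ∪ B.fmls, M.Holds φ

/-- The models of the theory of arrays with maxdiff, with total orders with `0` as index theory. -/
structure ArdModel where
  Index : Type
  Elem : Type
  Arr : Type
  [order : LinearOrder Index]
  zero : Index
  bot : Elem
  eps : Arr
  rd : Arr → Index → Elem
  wr : Arr → Index → Elem → Arr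
  diff : Arr → Arr → Index
  rd_wr_same : ∀ y i e, zero ≤ i → rd (wr y i e) i = e
  rd_wr_other : ∀ y i j e, i ≠ j → rd (wr y i e) j = rd y j
  rd_diff_ne : ∀ x y, x ≠ y → rd x (diff x y) ≠ rd y (diff x y)
  rd_eq_of_diff_lt : ∀ x y i, diff x y < i → rd x i = rd y i
  diff_self : ∀ x, diff x x = zero
  rd_neg : ∀ x i, i < zero → rd x i = bot
  rd_eps : ∀ i, rd eps i = bot

attribute [instance] ArdModel.order

namespace ArdModel

variable (M : ArdModel)

/-- `iterArr a b k` is the array `b_{k+1}`, where `b_1 = b` and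
`b_{k+1} = wr(b_k, diff(a,b_k), rd(a, diff(a,b_k)))`. -/
def iterArr (a b : M.Arr) : ℕ → M.Arr
  | 0 => b
  | k + 1 =>
    M.wr (iterArr a b k) (M.diff a (iterArr a b k)) (M.rd a (M.diff a (iterArr a b k)))

/-- `iterDiff a b k` is `diff_{k+1}(a,b) = diff(a, b_{k+1})`. -/
def iterDiff (a b : M.Arr) (k : ℕ) : M.Index := M.diff a (M.iterArr a b k)

/-- An assignment of values to the variables of the three sorts. -/
structure Assignment where
  idxVal : ℕ → M.Index
  elVal : ℕ → M.Elem
  arrVal : ℕ → M.Arr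

variable {M} (v : M.Assignment)

def Assignment.arr : ArrTerm → M.Arr
  | .var x => v.arrVal x
  | .eps => M.eps

/-- Formulae in which arrays occur only under `rd` are evaluated by reading `rd(a, ·)` as the
function `f_a`. -/
def Assignment.toModel : ToEufModel where
  Index := M.Index
  Elem := M.Elem
  zero := M.zero
  bot := M.bot
  func := fun a i => M.rd (v.arr a) i
  idxVal := v.idxVal
  elVal := v.elVal

def Assignment.HoldsFml (φ : Fml) : Prop := v.toModel.Holds φ

def Assignment.HoldsDef : DefAtom → Prop
  | .diff k a b i => M.iterDiff (v.arr a) (v.arr b) k = v.toModel.idx i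
  | .wr a b i e => v.arr a = M.wr (v.arr b) (v.toModel.idx i) (v.toModel.el e)

end ArdModel

/-- `A ∧ B` is consistent modulo the theory of arrays with maxdiff. -/
def ArdConsistent (A B : FmlPair) : Prop :=
  ∃ (M : ArdModel) (v : M.Assignment),
    (∀ α ∈ A.defs ∪ B.defs, v.HoldsDef α) ∧ ∀ φ ∈ A.fmls ∪ B.fmls, v.HoldsFml φ

/-! ## The loop -/

/-- The common array variables of `A` and `B`.  The constant `ε` is treated as a common array
variable as soon as it occurs in an equality `diff_k(a,b) = i` or `a = wr(b,i,e)` of `A` or `B`. -/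
def commonArrs (A B : FmlPair) : Set ArrTerm :=
  {c | (∃ x, c = .var x ∧ x ∈ A.arrVars ∧ x ∈ B.arrVars) ∨
    (c = .eps ∧ ∃ α ∈ A.defs ∪ B.defs, ArrTerm.eps ∈ α.arrs)}

/-- `diff_{k+1}(c₁,c₂) = i` occurs, for some `i`, in both `A₁` and `B₁`. -/
def CommonDiff (A B : FmlPair) (k : ℕ) (c₁ c₂ : ArrTerm) : Prop :=
  ∃ i, DefAtom.diff k c₁ c₂ i ∈ A.defs ∧ DefAtom.diff k c₁ c₂ i ∈ B.defs

/-- Conjoin `diff_{k+1}(c₁,c₂) = x` to `Φ₁`. -/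
def FmlPair.addDiff (Φ : FmlPair) (k : ℕ) (c₁ c₂ : ArrTerm) (x : ℕ) : FmlPair where
  defs := insert (.diff k c₁ c₂ (.var x)) Φ.defs
  fmls := Φ.fmls

/-- One execution of the body of the loop, handling the pair `p = (c₁, c₂)`; it takes place only if
`A₂ ∧ B₂` is still consistent modulo `TO ∪ EUF`. -/
def LoopStep (p : ArrTerm × ArrTerm) (A B A' B' : FmlPair) : Prop :=
  ToEufConsistent A B ∧
  p.1 ∈ commonArrs A B ∧ p.2 ∈ commonArrs A B ∧ p.1 ≠ p.2 ∧
  ∃ k x : ℕ, (¬ CommonDiff A B k p.1 p.2) ∧ (∀ l < k, CommonDiff A B l p.1 p.2) ∧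
    x ∉ A.idxVars ∧ x ∉ B.idxVars ∧
    A' = (A.addDiff k p.1 p.2 x).instantiate ∧ B' = (B.addDiff k p.1 p.2 x).instantiate

/-- `LoopRun A B ps A' B'`: starting from `(A, B)`, the loop can be executed `ps.length` times,
handling successively the pairs in `ps`, and reaches `(A', B')`. -/
inductive LoopRun (A B : FmlPair) : List (ArrTerm × ArrTerm) → FmlPair → FmlPair → Prop
  | start : LoopRun A B [] A B
  | step {ps : List (ArrTerm × ArrTerm)} {A₁ B₁ A₂ B₂ : FmlPair} (p : ArrTerm × ArrTerm) :
      LoopRun A B ps A₁ B₁ → LoopStep p A₁ B₁ A₂ B₂ → LoopRun A B (ps ++ [p]) A₂ B₂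

/-- How many times the unordered pair `{c, d}` is handled in `ps`. -/
def timesHandled (ps : List (ArrTerm × ArrTerm)) (c d : ArrTerm) : ℕ :=
  ps.count (c, d) + ps.count (d, c)

/-- The unordered pairs of distinct elements of `C` are handled in a fair way: each of them always in
the same order of its two members, and at each moment no pair has been handled more than once more
than another one. -/
def Fair (C : Set ArrTerm) (ps : List (ArrTerm × ArrTerm)) : Prop :=
  (∀ c d, (c, d) ∈ ps → (d, c) ∉ ps) ∧
  ∀ qs, qs <+: ps → ∀ c₁ ∈ C, ∀ c₂ ∈ C, c₁ ≠ c₂ → ∀ d₁ ∈ C, ∀ d₂ ∈ C, d₁ ≠ d₂ →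
    timesHandled qs c₁ c₂ ≤ timesHandled qs d₁ d₂ + 1

end MaxDiff

/-! Suppose `A₂ ∧ B₂` is still consistent when every pair of distinct common arrays has been handled
`n + 1` times, and let `M` be a model of it. A model of the initial `A ∧ B` modulo maxdiff arrays is
built over the finite set `X` of values in `M` of all current index terms. Its arrays are all
functions on `X` that are `⊥` below `0`; diffs exist because `X` is finite.

The instances of one side control its arrays only at that side's own terms. At a value `t` named
only by the other side, an array `a` takes the value of a common array `c` to which the initial
equalities tie it at `t`, and `⊥` if there is none (`extend`). Everything rests on this being
independent of `c` (`Side.func_eq_of_eqvGen`). If common `c`, `d` are tied at `t > 0` but differ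
there, the companion's instances put all `n + 1` shared iterated diffs of `c`, `d` above `t`. They
are positive, hence strictly decreasing, and `c`, `d` differ at each of them. A chain of initial
equalities that ties `c` to `d` at `t` can fail at a larger index only if that index is the value of
an initial index variable. So `n + 1` distinct values would come from at most `n` variables.

The extended functions agree with `M` on all terms of their own side, agree across sides on common
arrays, and satisfy the initial equalities; for iterated diffs this is `ArdModel.iterDiff_eq`. Hence
`A ∧ B` is consistent, against the assumption. Finally, a fair sequence of `(m² - m)/2 · (n + 1)`
steps handles each pair `n + 1` times by counting, and while consistency holds a fair step can
always be made, so a run cannot get stuck early. -/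

namespace MaxDiff

/-! ## Evaluation of the derived connectives -/

namespace ToEufModel

variable (M : ToEufModel)

@[simp] theorem holds_neg (φ : Fml) : M.Holds (.neg φ) ↔ ¬ M.Holds φ := Iff.rfl

@[simp] theorem holds_and (φ ψ : Fml) : M.Holds (.and φ ψ) ↔ M.Holds φ ∧ M.Holds ψ := Iff.rfl

@[simp] theorem holds_tru : M.Holds .tru := trivial

@[simp] theorem holds_idxEq (s t : IdxTerm) : M.Holds (.idxEq s t) ↔ M.idx s = M.idx t := Iff.rfl

@[simp] theorem holds_idxLe (s t : IdxTerm) : M.Holds (.idxLe s t) ↔ M.idx s ≤ M.idx t := Iff.rfl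

@[simp] theorem holds_rdEqRd (a : ArrTerm) (i : IdxTerm) (b : ArrTerm) (j : IdxTerm) :
    M.Holds (.rdEqRd a i b j) ↔ M.func a (M.idx i) = M.func b (M.idx j) := Iff.rfl

@[simp] theorem holds_or (φ ψ : Fml) : M.Holds (φ.or ψ) ↔ M.Holds φ ∨ M.Holds ψ := by
  simp only [Fml.or, holds_neg, holds_and]; tauto

@[simp] theorem holds_imp (φ ψ : Fml) : M.Holds (φ.imp ψ) ↔ (M.Holds φ → M.Holds ψ) := by
  simp only [Fml.imp, holds_neg, holds_or]; tauto

@[simp] theorem holds_idxLt (s t : IdxTerm) : M.Holds (.idxLt s t) ↔ M.idx s < M.idx t := by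
  simp only [Fml.idxLt, holds_neg, holds_and, holds_idxLe, holds_idxEq, lt_iff_le_and_ne, ne_eq]

theorem holds_bigAnd (l : List Fml) : M.Holds (.bigAnd l) ↔ ∀ φ ∈ l, M.Holds φ := by
  induction l with
  | nil => simp [Fml.bigAnd]
  | cons φ l ih => simp [Fml.bigAnd, ih]

theorem holds_bigOr (l : List Fml) : M.Holds (.bigOr l) ↔ ∃ φ ∈ l, M.Holds φ := by
  induction l with
  | nil => simp [Fml.bigOr]
  | cons φ l ih => simp [Fml.bigOr, ih]

variable {M}

theorem le_of_holds_diffMono {js : List IdxTerm} {k k' : IdxTerm}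
    (h : M.Holds (diffMono (js ++ [k, k']))) : M.idx k' ≤ M.idx k := by
  induction js with
  | nil => exact h.1
  | cons j js ih => cases js <;> exact ih h.2

theorem eq_zero_of_holds_diffRepeat {js : List IdxTerm} {k k' : IdxTerm}
    (h : M.Holds (diffRepeat (js ++ [k, k']))) (hk : M.idx k = M.idx k') : M.idx k = M.zero := by
  induction js with
  | nil => exact (M.holds_imp _ _).1 h.1 hk
  | cons j js ih => cases js <;> exact ih h.2

theorem eq_zero_of_holds_diffZero {a b : ArrTerm} {ks : List IdxTerm}
    (h : M.Holds (diffZero a b ks)) {k : IdxTerm} (hk : k ∈ ks)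
    (hab : M.func a (M.idx k) = M.func b (M.idx k)) : M.idx k = M.zero := by
  have := (M.holds_bigAnd _).1 h _ (List.mem_map_of_mem hk)
  exact (M.holds_imp _ _).1 this hab

/-- The values of the index terms instantiating the pair. -/
def points (M : ToEufModel) (Φ : FmlPair) : Set M.Index := M.idx '' Φ.instTerms

theorem zero_mem_points (M : ToEufModel) (Φ : FmlPair) : M.zero ∈ M.points Φ :=
  ⟨.zero, Set.empty_subset _, rfl⟩

end ToEufModel

/-! ## Chains of iterated diffs -/

namespace FmlPair

theorem vars_subset_of_mem_defs {Φ : FmlPair} {α : DefAtom} (h : α ∈ Φ.defs) :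
    α.idxVars ⊆ Φ.idxVars := fun _ hx => Or.inl (Set.mem_biUnion h hx)

theorem vars_subset_of_mem_fmls {Φ : FmlPair} {φ : Fml} (h : φ ∈ Φ.fmls) :
    φ.idxVars ⊆ Φ.idxVars := fun _ hx => Or.inr (Set.mem_biUnion h hx)

theorem hasDiffs_map_range {Φ : FmlPair} {a b : ArrTerm} {κ : ℕ → IdxTerm} {l : ℕ}
    (h : ∀ j ≤ l, DefAtom.diff j a b (κ j) ∈ Φ.defs) :
    Φ.HasDiffs a b ((List.range (l + 1)).map κ) := by
  refine ⟨by simp, fun j hj => ?_⟩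
  simp only [List.length_map, List.length_range] at hj
  simpa using h j (by omega)

end FmlPair

section Chain

variable {M : ToEufModel} {Φ : FmlPair} (hM : ∀ φ, Φ.Added φ → M.Holds φ)
  {a b : ArrTerm} {κ : ℕ → IdxTerm} {l : ℕ}
  (h : ∀ j ≤ l, DefAtom.diff j a b (κ j) ∈ Φ.defs)

include hM h

theorem chain_eq_zero (hab : M.func a (M.idx (κ l)) = M.func b (M.idx (κ l))) :
    M.idx (κ l) = M.zero :=
  ToEufModel.eq_zero_of_holds_diffZero
    (hM _ (.diffZero a b _ (FmlPair.hasDiffs_map_range h)))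
    (List.mem_map_of_mem (List.mem_range.2 (Nat.lt_succ_self l))) hab

theorem chain_le {j : ℕ} (hj : j < l) : M.idx (κ (j + 1)) ≤ M.idx (κ j) := by
  -- The chain is cut off at level `j + 1`, so that the two indices compared are the last entries of
  -- the list.
  have := hM _ (.diffMono a b _ (FmlPair.hasDiffs_map_range
    (κ := κ) (l := j + 1) fun i hi => h i (by omega)))
  rw [List.range_succ, List.range_succ, List.map_append, List.map_append, List.append_assoc] at this
  exact ToEufModel.le_of_holds_diffMono this

theorem chain_repeat {j : ℕ} (hj : j < l) (he : M.idx (κ j) = M.idx (κ (j + 1))) :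
    M.idx (κ j) = M.zero := by
  have := hM _ (.diffRepeat a b _ (FmlPair.hasDiffs_map_range
    (κ := κ) (l := j + 1) fun i hi => h i (by omega)))
  rw [List.range_succ, List.range_succ, List.map_append, List.map_append, List.append_assoc] at this
  exact ToEufModel.eq_zero_of_holds_diffRepeat this he

theorem chain_agree {t : M.Index} (ht : t ∈ M.points Φ) (hlt : M.idx (κ l) < t) :
    M.func a t = M.func b t ∨ ∃ j < l, t = M.idx (κ j) := by
  obtain ⟨t, ht, rfl⟩ := ht
  have hd := FmlPair.hasDiffs_map_range h
  rw [List.range_succ, List.map_append] at hd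
  have := hM _ (.diffInst a b _ _ hd t ht)
  simp only [diffInst, ToEufModel.holds_imp, ToEufModel.holds_idxLt, ToEufModel.holds_or,
    ToEufModel.holds_rdEqRd, ToEufModel.holds_bigOr] at this
  refine (this hlt).imp_right ?_
  rintro ⟨φ, hφ, hh⟩
  simp only [List.map_map, List.mem_map, List.mem_range, Function.comp] at hφ
  obtain ⟨j, hj, rfl⟩ := hφ
  exact ⟨j, hj, hh⟩

omit hM in
theorem chain_mem_points {j : ℕ} (hj : j ≤ l) : M.idx (κ j) ∈ M.points Φ :=
  ⟨κ j, FmlPair.vars_subset_of_mem_defs (h j hj), rfl⟩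

end Chain

/-! ## Extending the arrays of one of the two pairs -/

/-- `a` and `b` are forced by an equality of `Φ₁` to agree at every index `t` that is not the value
of an index term of `Φ`. -/
def Linked (M : ToEufModel) (Φ : FmlPair) (t : M.Index) (a b : ArrTerm) : Prop :=
  (∃ i e, DefAtom.wr a b i e ∈ Φ.defs) ∨
    ∃ (κ : ℕ → IdxTerm) (l : ℕ), (∀ j ≤ l, DefAtom.diff j a b (κ j) ∈ Φ.defs) ∧ M.idx (κ l) < t

/-- The situation of one of the two pairs: `Φ` is the initial pair, `Φ'` and `Ψ'` are the current
pair and its companion, and `M` satisfies the instances of both. -/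
structure Side (M : ToEufModel) (Φ Φ' Ψ' : FmlPair) (C : Set ArrTerm) (n : ℕ) : Prop where
  added : ∀ φ, Φ'.Added φ → M.Holds φ
  added_companion : ∀ φ, Ψ'.Added φ → M.Holds φ
  defs_subset : Φ.defs ⊆ Φ'.defs
  arr_mem : ∀ c ∈ C, ∀ x, c = .var x → x ∈ Ψ'.arrVars
  finite : Φ.idxVars.Finite
  ncard_le : Φ.idxVars.ncard ≤ n
  common : ∀ c ∈ C, ∀ d ∈ C, c ≠ d →
    (∀ l < n + 1, CommonDiff Φ' Ψ' l c d) ∨ ∀ l < n + 1, CommonDiff Φ' Ψ' l d c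

/-- The condition on `a` is vacuous for `ε`, whose own instance gives `⊥` at every term. -/
theorem func_eq_bot_of_neg {M : ToEufModel} {Φ : FmlPair} (hM : ∀ φ, Φ.Added φ → M.Holds φ)
    {t : M.Index} (ht : t ∈ M.points Φ) (hneg : t < M.zero) {a : ArrTerm}
    (ha : ∀ x, a = .var x → x ∈ Φ.arrVars) : M.func a t = M.bot := by
  obtain ⟨t, ht, rfl⟩ := ht
  cases a with
  | var x => exact (M.holds_imp _ _).1 (hM _ (.neg x (ha x rfl) t ht)) ((M.holds_idxLt _ _).2 hneg)
  | eps => exact hM _ (.eps t ht)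

open Classical in
/-- The extension of the arrays of `Φ` to indices that are not values of terms of `Φ'`. -/
noncomputable def extend (M : ToEufModel) (Φ Φ' : FmlPair) (C : Set ArrTerm) (a : ArrTerm)
    (t : M.Index) : M.Elem :=
  if t ∈ M.points Φ' then M.func a t
  else if h : ∃ c ∈ C, Relation.EqvGen (Linked M Φ t) a c then M.func h.choose t
  else M.bot

namespace Side

variable {M : ToEufModel} {Φ Φ' Ψ' : FmlPair} {C : Set ArrTerm} {n : ℕ}
  (S : Side M Φ Φ' Ψ' C n)

include S

theorem agree_wr {a b : ArrTerm} {i : IdxTerm} {e : ElTerm} (h : DefAtom.wr a b i e ∈ Φ.defs)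
    {t : M.Index} (ht : t ∈ M.points Φ') (hti : t ≠ M.idx i) : M.func a t = M.func b t := by
  obtain ⟨t, ht, rfl⟩ := ht
  exact (M.holds_imp _ _).1 (S.added _ (.wrInst a b i e (S.defs_subset h) t ht)) hti

/-- Each link at `t` still forces agreement at a larger `s`, except at the written index or at an
earlier diff of the chain. These exceptions are terms of the initial pair, and `0 < t < s` rules out
the term `0`. -/
theorem mem_image_of_func_ne {t : M.Index} (ht0 : M.zero < t) {a b : ArrTerm}
    (h : Relation.EqvGen (Linked M Φ t) a b) {s : M.Index} (hs : s ∈ M.points Φ') (hts : t < s)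
    (hne : M.func a s ≠ M.func b s) : s ∈ M.idxVal '' Φ.idxVars := by
  have key : ∀ {i : IdxTerm}, i.vars ⊆ Φ.idxVars → s = M.idx i → s ∈ M.idxVal '' Φ.idxVars := by
    rintro (x | _) hi rfl
    · exact ⟨x, hi rfl, rfl⟩
    · exact absurd (ht0.trans hts) (lt_irrefl _)
  by_contra hcon
  apply hne
  clear hne
  induction h with
  | rel a b hab =>
    obtain ⟨i, e, h⟩ | ⟨κ, l, h, hl⟩ := hab
    · by_contra hne
      refine hcon (key (FmlPair.vars_subset_of_mem_defs h) ?_)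
      by_contra hsi
      exact hne (S.agree_wr h hs hsi)
    · obtain h' | ⟨j, hj, rfl⟩ :=
        chain_agree S.added (fun j hj => S.defs_subset (h j hj)) hs (hl.trans hts)
      · exact h'
      · exact absurd (key (FmlPair.vars_subset_of_mem_defs (h j hj.le)) rfl) hcon
  | refl a => rfl
  | symm a b _ ih => exact ih.symm
  | trans a b c _ _ ih₁ ih₂ => exact ih₁.trans ih₂

/-- The pigeonhole argument: a disagreement at `t` would make the `n + 1` shared diffs distinct
values of the at most `n` variables of the initial pair. -/
theorem func_eq_of_eqvGen_aux {c d : ArrTerm} {t : M.Index} (htΨ : t ∈ M.points Ψ')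
    (htΦ : t ∉ M.points Φ') (ht0 : M.zero < t) (h : Relation.EqvGen (Linked M Φ t) c d)
    (hcd : ∀ l < n + 1, CommonDiff Φ' Ψ' l c d) : M.func c t = M.func d t := by
  by_contra hne
  have hex : ∀ l, ∃ i, l < n + 1 →
      DefAtom.diff l c d i ∈ Φ'.defs ∧ DefAtom.diff l c d i ∈ Ψ'.defs := fun l => by
    by_cases hl : l < n + 1
    · exact (hcd l hl).imp fun i hi _ => hi
    -- A dummy value: levels beyond `n` are never consulted.
    · exact ⟨.zero, fun h => absurd h hl⟩
  choose κ hκ using hex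
  have hΦ : ∀ l < n + 1, ∀ j ≤ l, DefAtom.diff j c d (κ j) ∈ Φ'.defs :=
    fun l hl j hj => (hκ j (by omega)).1
  have hΨ : ∀ l < n + 1, ∀ j ≤ l, DefAtom.diff j c d (κ j) ∈ Ψ'.defs :=
    fun l hl j hj => (hκ j (by omega)).2
  have hmem : ∀ l < n + 1, M.idx (κ l) ∈ M.points Φ' :=
    fun l hl => chain_mem_points (hΦ l hl) le_rfl
  have hlt : ∀ l < n + 1, t < M.idx (κ l) := fun l hl => by
    refine lt_of_le_of_ne (not_lt.1 fun hlt => ?_) fun h => htΦ (h ▸ hmem l hl)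
    obtain h' | ⟨j, hj, rfl⟩ := chain_agree S.added_companion (hΨ l hl) htΨ hlt
    · exact hne h'
    · exact htΦ (hmem j (by omega))
  have hne0 : ∀ l < n + 1, M.idx (κ l) ≠ M.zero := fun l hl => (ht0.trans (hlt l hl)).ne'
  have hstep : ∀ j, j + 1 < n + 1 → M.idx (κ (j + 1)) < M.idx (κ j) := fun j hj =>
    lt_of_le_of_ne (chain_le S.added (hΦ (j + 1) hj) (Nat.lt_succ_self j)) fun he =>
      hne0 j (by omega) (chain_repeat S.added (hΦ (j + 1) hj) (Nat.lt_succ_self j) he.symm)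
  have hanti : ∀ i j, i < j → j < n + 1 → M.idx (κ j) < M.idx (κ i) := by
    intro i j hij
    induction j, hij using Nat.le_induction with
    | base => exact fun hj => hstep i hj
    | succ j hij ih => exact fun hj => (hstep j hj).trans (ih (by omega))
  have himg : ∀ l < n + 1, M.idx (κ l) ∈ M.idxVal '' Φ.idxVars := fun l hl =>
    S.mem_image_of_func_ne ht0 h (hmem l hl) (hlt l hl)
      fun he => hne0 l hl (chain_eq_zero S.added (hΦ l hl) he)
  have hinj : Set.InjOn (fun l => M.idx (κ l)) (Set.Iio (n + 1)) := by
    intro i hi j hj hij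
    rcases lt_trichotomy i j with h' | h' | h'
    · exact absurd hij (hanti i j h' hj).ne'
    · exact h'
    · exact absurd hij (hanti j i h' hi).ne
  have h1 : ((fun l => M.idx (κ l)) '' Set.Iio (n + 1)).ncard ≤ (M.idxVal '' Φ.idxVars).ncard :=
    Set.ncard_le_ncard (by rintro _ ⟨l, hl, rfl⟩; exact himg l hl) (S.finite.image _)
  rw [hinj.ncard_image, ← Finset.coe_Iio, Set.ncard_coe_finset, Nat.card_Iio] at h1
  have h2 := (Set.ncard_image_le (f := M.idxVal) S.finite).trans S.ncard_le
  omega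

theorem func_eq_of_eqvGen {c d : ArrTerm} (hc : c ∈ C) (hd : d ∈ C) {t : M.Index}
    (htΨ : t ∈ M.points Ψ') (htΦ : t ∉ M.points Φ')
    (h : Relation.EqvGen (Linked M Φ t) c d) : M.func c t = M.func d t := by
  rcases lt_trichotomy t M.zero with ht | ht | ht
  · rw [func_eq_bot_of_neg S.added_companion htΨ ht (S.arr_mem c hc),
      func_eq_bot_of_neg S.added_companion htΨ ht (S.arr_mem d hd)]
  · exact absurd (ht ▸ M.zero_mem_points Φ') htΦ
  · by_cases hcd : c = d
    · rw [hcd]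
    · rcases S.common c hc d hd hcd with h' | h'
      · exact S.func_eq_of_eqvGen_aux htΨ htΦ ht h h'
      · exact (S.func_eq_of_eqvGen_aux htΨ htΦ ht (h.symm _ _) h').symm

omit S in
theorem extend_of_mem {t : M.Index} (ht : t ∈ M.points Φ') (a : ArrTerm) :
    extend M Φ Φ' C a t = M.func a t := if_pos ht

/-- The chosen common array and `c` are linked through `a`, so the choice is immaterial. -/
theorem extend_of_eqvGen {a c : ArrTerm} (hc : c ∈ C) {t : M.Index}
    (htΨ : t ∈ M.points Ψ') (htΦ : t ∉ M.points Φ')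
    (h : Relation.EqvGen (Linked M Φ t) a c) : extend M Φ Φ' C a t = M.func c t := by
  have hex : ∃ c ∈ C, Relation.EqvGen (Linked M Φ t) a c := ⟨c, hc, h⟩
  rw [extend, if_neg htΦ, dif_pos hex]
  exact S.func_eq_of_eqvGen hex.choose_spec.1 hc htΨ htΦ
    ((hex.choose_spec.2.symm _ _).trans _ _ _ h)

/-- This makes the two sides compatible: on common arrays both extensions coincide with `M`. -/
theorem extend_common {c : ArrTerm} (hc : c ∈ C) {t : M.Index}
    (ht : t ∈ M.points Φ' ∪ M.points Ψ') : extend M Φ Φ' C c t = M.func c t := by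
  by_cases htΦ : t ∈ M.points Φ'
  · exact extend_of_mem htΦ c
  · exact S.extend_of_eqvGen hc (ht.resolve_left htΦ) htΦ (.refl c)

theorem extend_congr {a b : ArrTerm} {t : M.Index}
    (htΨ : t ∈ M.points Ψ') (htΦ : t ∉ M.points Φ') (h : Linked M Φ t a b) :
    extend M Φ Φ' C a t = extend M Φ Φ' C b t := by
  by_cases hex : ∃ c ∈ C, Relation.EqvGen (Linked M Φ t) b c
  · obtain ⟨c, hc, hbc⟩ := hex
    rw [S.extend_of_eqvGen hc htΨ htΦ hbc,
      S.extend_of_eqvGen hc htΨ htΦ ((Relation.EqvGen.rel _ _ h).trans _ _ _ hbc)]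
  · have hex' : ¬ ∃ c ∈ C, Relation.EqvGen (Linked M Φ t) a c := fun ⟨c, hc, hac⟩ =>
      hex ⟨c, hc, ((Relation.EqvGen.rel _ _ h).symm _ _).trans _ _ _ hac⟩
    rw [extend, extend, if_neg htΦ, if_neg htΦ, dif_neg hex, dif_neg hex']

theorem extend_wr {a b : ArrTerm} {i : IdxTerm} {e : ElTerm} (h : DefAtom.wr a b i e ∈ Φ.defs)
    {t : M.Index} (ht : t ∈ M.points Φ' ∪ M.points Ψ') (hti : t ≠ M.idx i) :
    extend M Φ Φ' C a t = extend M Φ Φ' C b t := by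
  by_cases htΦ : t ∈ M.points Φ'
  · rw [extend_of_mem htΦ, extend_of_mem htΦ, S.agree_wr h htΦ hti]
  · exact S.extend_congr (ht.resolve_left htΦ) htΦ (.inl ⟨i, e, h⟩)

theorem extend_wr_same {a b : ArrTerm} {i : IdxTerm} {e : ElTerm}
    (h : DefAtom.wr a b i e ∈ Φ.defs) (hi : M.zero ≤ M.idx i) :
    extend M Φ Φ' C a (M.idx i) = M.el e := by
  have h' := S.defs_subset h
  rw [extend_of_mem ⟨i, FmlPair.vars_subset_of_mem_defs h', rfl⟩]
  exact (M.holds_imp _ _).1 (S.added _ (.wrGround a b i e h')) hi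

theorem extend_agree {a b : ArrTerm} {κ : ℕ → IdxTerm} {l : ℕ}
    (h : ∀ j ≤ l, DefAtom.diff j a b (κ j) ∈ Φ.defs) {t : M.Index}
    (ht : t ∈ M.points Φ' ∪ M.points Ψ') (hlt : M.idx (κ l) < t) :
    extend M Φ Φ' C a t = extend M Φ Φ' C b t ∨ ∃ j < l, t = M.idx (κ j) := by
  by_cases htΦ : t ∈ M.points Φ'
  · rw [extend_of_mem htΦ, extend_of_mem htΦ]
    exact chain_agree S.added (fun j hj => S.defs_subset (h j hj)) htΦ hlt
  · exact .inl (S.extend_congr (ht.resolve_left htΦ) htΦ (.inr ⟨κ, l, h, hlt⟩))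

theorem extend_of_neg {a : ArrTerm} (ha : ∀ x, a = .var x → x ∈ Φ'.arrVars) {t : M.Index}
    (ht : t ∈ M.points Φ' ∪ M.points Ψ') (hneg : t < M.zero) :
    extend M Φ Φ' C a t = M.bot := by
  by_cases htΦ : t ∈ M.points Φ'
  · rw [extend_of_mem htΦ, func_eq_bot_of_neg S.added htΦ hneg ha]
  · by_cases hex : ∃ c ∈ C, Relation.EqvGen (Linked M Φ t) a c
    · obtain ⟨c, hc, h⟩ := hex
      rw [S.extend_of_eqvGen hc (ht.resolve_left htΦ) htΦ h]
      exact func_eq_bot_of_neg S.added_companion (ht.resolve_left htΦ) hneg (S.arr_mem c hc)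
    · rw [extend, if_neg htΦ, dif_neg hex]

end Side

/-! ## Iterated diffs in a model -/

namespace ArdModel

variable (N : ArdModel)

theorem zero_le_diff (x y : N.Arr) : N.zero ≤ N.diff x y := by
  by_contra h
  have hne : x ≠ y := by rintro rfl; exact h (N.diff_self x).ge
  exact N.rd_diff_ne x y hne (by rw [N.rd_neg _ _ (not_le.1 h), N.rd_neg _ _ (not_le.1 h)])

theorem diff_eq_of_ne {x y : N.Arr} {k : N.Index} (hk : N.rd x k ≠ N.rd y k)
    (h : ∀ t, k < t → N.rd x t = N.rd y t) : N.diff x y = k := by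
  have hne : x ≠ y := by rintro rfl; exact hk rfl
  apply le_antisymm
  · exact not_lt.1 fun hlt => N.rd_diff_ne x y hne (h _ hlt)
  · exact not_lt.1 fun hlt => hk (N.rd_eq_of_diff_lt x y k hlt)

theorem diff_eq_zero {x y : N.Arr} (h : ∀ t, N.zero < t → N.rd x t = N.rd y t) :
    N.diff x y = N.zero := by
  by_cases hxy : x = y
  · rw [hxy, N.diff_self]
  · exact le_antisymm (not_lt.1 fun hlt => N.rd_diff_ne x y hxy (h _ hlt)) (N.zero_le_diff x y)

/-- Copying a value of `x` works at negative indices too, where both arrays read `⊥`. -/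
theorem rd_wr_of_rd (x y : N.Arr) (i t : N.Index) :
    (t = i → N.rd (N.wr y i (N.rd x i)) t = N.rd x t) ∧
    (t ≠ i → N.rd (N.wr y i (N.rd x i)) t = N.rd y t) := by
  refine ⟨?_, fun h => N.rd_wr_other _ _ _ _ h.symm⟩
  rintro rfl
  by_cases ht : N.zero ≤ t
  · exact N.rd_wr_same _ _ _ ht
  · rw [N.rd_neg _ _ (not_le.1 ht), N.rd_neg _ _ (not_le.1 ht)]

/-- By induction the `j`-th iterated array equals `x` at `κ 0, …, κ (j - 1)` and `y` elsewhere. A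
nonzero `κ j` is new, so it is the largest index where `x` differs from that array; if `κ j = 0`,
agreement above `0` suffices because diffs are never negative. -/
theorem iterDiff_eq {x y : N.Arr} {κ : ℕ → N.Index} {l : ℕ}
    (hle : ∀ j < l, κ (j + 1) ≤ κ j)
    (hrep : ∀ j < l, κ j = κ (j + 1) → κ j = N.zero)
    (hzero : ∀ j ≤ l, N.rd x (κ j) = N.rd y (κ j) → κ j = N.zero)
    (hagree : ∀ j ≤ l, ∀ t, κ j < t → N.rd x t = N.rd y t ∨ ∃ i < j, t = κ i) :
    ∀ j ≤ l, N.iterDiff x y j = κ j := by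
  have hmono : ∀ i j, i ≤ j → j ≤ l → κ j ≤ κ i := by
    intro i j hij
    induction j, hij using Nat.le_induction with
    | base => exact fun _ => le_rfl
    | succ j hij ih => exact fun hj => (hle j (by omega)).trans (ih (by omega))
  have main : ∀ j ≤ l, (∀ t, (∃ i < j, t = κ i) → N.rd (N.iterArr x y j) t = N.rd x t) →
      (∀ t, (¬ ∃ i < j, t = κ i) → N.rd (N.iterArr x y j) t = N.rd y t) →
      N.iterDiff x y j = κ j := by
    intro j hj h1 h2
    have hab : ∀ t, κ j < t → N.rd x t = N.rd (N.iterArr x y j) t := fun t ht => by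
      by_cases hex : ∃ i < j, t = κ i
      · exact (h1 t hex).symm
      · rw [h2 t hex]
        exact (hagree j hj t ht).resolve_right hex
    by_cases h0 : κ j = N.zero
    · rw [h0] at hab ⊢
      exact N.diff_eq_zero hab
    · refine N.diff_eq_of_ne ?_ hab
      rw [h2]
      · exact fun h => h0 (hzero j hj h)
      · rintro ⟨i, hi, he⟩
        -- By monotonicity any repetition already forces an adjacent one.
        have h3 : κ i = κ (i + 1) :=
          le_antisymm (he ▸ hmono (i + 1) j hi hj) (hle i (by omega))
        exact h0 (he ▸ hrep i (by omega) h3)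
  have inv : ∀ j ≤ l, (∀ t, (∃ i < j, t = κ i) → N.rd (N.iterArr x y j) t = N.rd x t) ∧
      (∀ t, (¬ ∃ i < j, t = κ i) → N.rd (N.iterArr x y j) t = N.rd y t) := by
    intro j
    induction j with
    | zero => exact fun _ => ⟨fun t ⟨i, hi, _⟩ => absurd hi (Nat.not_lt_zero i), fun _ _ => rfl⟩
    | succ j ih =>
      intro hj
      obtain ⟨h1, h2⟩ := ih (by omega)
      have hd : N.diff x (N.iterArr x y j) = κ j := main j (by omega) h1 h2
      have hw := N.rd_wr_of_rd x (N.iterArr x y j) (κ j)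
      simp only [iterArr, hd]
      constructor
      · rintro t ⟨i, hi, ht⟩
        by_cases htj : t = κ j
        · exact (hw t).1 htj
        · rw [(hw t).2 htj]
          refine h1 t ⟨i, ?_, ht⟩
          rcases Nat.lt_succ_iff_lt_or_eq.1 hi with h | rfl
          · exact h
          · exact absurd ht htj
      · intro t ht
        rw [(hw t).2 fun h => ht ⟨j, Nat.lt_succ_self j, h⟩]
        exact h2 t fun ⟨i, hi, h⟩ => ht ⟨i, hi.trans (Nat.lt_succ_self j), h⟩
  exact fun j hj => main j hj (inv j hj).1 (inv j hj).2

end ArdModel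

/-! ## Models over a finite order -/

theorem exists_maxdiff {I E : Type} [LinearOrder I] [Finite I] (zero : I) (x y : I → E) :
    ∃ d, (x ≠ y → x d ≠ y d) ∧ (∀ i, d < i → x i = y i) ∧ (x = y → d = zero) := by
  by_cases hxy : x = y
  · exact ⟨zero, fun h => absurd hxy h, fun i _ => by rw [hxy], fun _ => rfl⟩
  · obtain ⟨i, hi⟩ := Function.ne_iff.1 hxy
    obtain ⟨d, hd, hmax⟩ := Set.exists_max_image {i | x i ≠ y i} id (Set.toFinite _) ⟨i, hi⟩
    exact ⟨d, fun _ => hd, fun i hdi => by_contra fun h => (hmax i h).not_gt hdi,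
      fun h => absurd h hxy⟩

open Classical in
/-- The model whose arrays are all functions on a finite order with value `⊥` at negative indices. -/
noncomputable def functionModel (I E : Type) [LinearOrder I] [Finite I] (zero : I) (bot : E) :
    ArdModel where
  Index := I
  Elem := E
  Arr := {f : I → E // ∀ i < zero, f i = bot}
  zero := zero
  bot := bot
  eps := ⟨fun _ => bot, fun _ _ => rfl⟩
  rd x i := x.1 i
  -- Writing at a negative index has no effect, which keeps the value `⊥` there.
  wr x i e := ⟨fun j => if j = i ∧ zero ≤ i then e else x.1 j, fun j hj => by
    refine (if_neg ?_).trans (x.2 j hj)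
    rintro ⟨rfl, h⟩
    exact absurd hj h.not_gt⟩
  diff x y := (exists_maxdiff zero x.1 y.1).choose
  rd_wr_same _ _ _ h := if_pos ⟨rfl, h⟩
  rd_wr_other _ _ _ _ h := if_neg fun h' => h h'.1.symm
  rd_diff_ne x y h := (exists_maxdiff zero x.1 y.1).choose_spec.1 fun h' => h (Subtype.ext h')
  rd_eq_of_diff_lt x y := (exists_maxdiff zero x.1 y.1).choose_spec.2.1
  diff_self x := (exists_maxdiff zero x.1 x.1).choose_spec.2.2 rfl
  rd_neg x := x.2
  rd_eps _ := rfl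

theorem wr_functionModel_apply {I E : Type} [LinearOrder I] [Finite I] (zero : I) (bot : E)
    (x : (functionModel I E zero bot).Arr) (i : I) (e : E) (j : I) :
    ((functionModel I E zero bot).wr x i e).1 j = if j = i ∧ zero ≤ i then e else x.1 j := by
  simp only [functionModel]

/-- Formulae only depend on the values of `rd` at the terms and arrays occurring in them. -/
theorem holds_iff_of_agree {M N : ToEufModel} {Φ : FmlPair} (ι : N.Index → M.Index)
    (hι : ∀ s t, ι s ≤ ι t ↔ s ≤ t) (hinj : Function.Injective ι)
    (hidx : ∀ s ∈ Φ.instTerms, ι (N.idx s) = M.idx s)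
    (ε : N.Elem → M.Elem) (hε : Function.Injective ε) (hel : ∀ e, ε (N.el e) = M.el e)
    (φ : Fml) (hφ : φ.idxVars ⊆ Φ.idxVars)
    (hfunc : ∀ a ∈ φ.arrs, ∀ s ∈ Φ.instTerms, ε (N.func a (N.idx s)) = M.func a (M.idx s)) :
    N.Holds φ ↔ M.Holds φ := by
  induction φ with
  | idxEq s t =>
    have hs := hidx s (Set.subset_union_left.trans hφ)
    have ht := hidx t (Set.subset_union_right.trans hφ)
    simp only [ToEufModel.Holds, ← hs, ← ht, hinj.eq_iff]
  | idxLe s t =>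
    have hs := hidx s (Set.subset_union_left.trans hφ)
    have ht := hidx t (Set.subset_union_right.trans hφ)
    simp only [ToEufModel.Holds, ← hs, ← ht, hι]
  | rdEqRd a i b j =>
    have hi := hfunc a (.inl rfl) i (Set.subset_union_left.trans hφ)
    have hj := hfunc b (.inr rfl) j (Set.subset_union_right.trans hφ)
    simp only [ToEufModel.Holds, ← hi, ← hj, hε.eq_iff]
  | rdEq a i e =>
    have hi := hfunc a rfl i hφ
    simp only [ToEufModel.Holds, ← hi, ← hel, hε.eq_iff]
  | elEq e₁ e₂ => simp only [ToEufModel.Holds, ← hel, hε.eq_iff]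
  | tru => exact Iff.rfl
  | neg φ ih => exact not_congr (ih hφ hfunc)
  | and φ ψ ih₁ ih₂ =>
    exact and_congr
      (ih₁ (Set.subset_union_left.trans hφ) fun a ha => hfunc a (.inl ha))
      (ih₂ (Set.subset_union_right.trans hφ) fun a ha => hfunc a (.inr ha))

namespace FmlPair

variable {Φ : FmlPair}

theorem IsSeparated.exists_chain (h : Φ.IsSeparated) {k : ℕ} {a b : ArrTerm} {i : IdxTerm}
    (hk : DefAtom.diff k a b i ∈ Φ.defs) :
    ∃ κ : ℕ → IdxTerm, κ k = i ∧ ∀ j ≤ k, DefAtom.diff j a b (κ j) ∈ Φ.defs := by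
  have hex : ∀ j, ∃ i', j < k → DefAtom.diff j a b i' ∈ Φ.defs := fun j => by
    by_cases hj : j < k
    · exact (h k a b i hk j hj).imp fun _ hi _ => hi
    · exact ⟨i, fun h => absurd h hj⟩
  choose κ hκ using hex
  -- Lower levels are chosen arbitrarily, but the top one must be the prescribed `i`.
  refine ⟨Function.update κ k i, by simp, fun j hj => ?_⟩
  rcases hj.lt_or_eq with hlt | rfl
  · rw [Function.update_of_ne hlt.ne]
    exact hκ j hlt
  · simpa using hk

theorem mem_arrVars_of_mem_defs {α : DefAtom} (h : α ∈ Φ.defs) {x : ℕ}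
    (hx : ArrTerm.var x ∈ α.arrs) : x ∈ Φ.arrVars := .inl ⟨α, h, hx⟩

end FmlPair

/-! ### The initial equalities of one side hold in the function model -/

section Glue

variable {M : ToEufModel} {X : Set M.Index} [Finite X] (z : X) (hz : z.1 = M.zero)
  (v : (functionModel X M.Elem z M.bot).Assignment)

include hz

theorem Side.holdsDef {Φ Φ' Ψ' : FmlPair} {C : Set ArrTerm} {n : ℕ}
    (S : Side M Φ Φ' Ψ' C n) (hX : ∀ t ∈ X, t ∈ M.points Φ' ∪ M.points Ψ')
    (hsep : Φ.IsSeparated)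
    (hidx : ∀ s ∈ Φ.instTerms, (v.toModel.idx s : X).1 = M.idx s)
    (hel : ∀ e, v.toModel.el e = M.el e)
    (hrd : ∀ α ∈ Φ.defs, ∀ a ∈ α.arrs, ∀ t : X, (v.arr a).1 t = extend M Φ Φ' C a t.1)
    (α : DefAtom) (hα : α ∈ Φ.defs) : v.HoldsDef α := by
  cases α with
  | diff k a b i =>
    obtain ⟨κ, rfl, hκ⟩ := hsep.exists_chain hα
    have hκ' : ∀ j ≤ k, DefAtom.diff j a b (κ j) ∈ Φ'.defs := fun j hj => S.defs_subset (hκ j hj)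
    have hi : ∀ j ≤ k, (v.toModel.idx (κ j) : X).1 = M.idx (κ j) := fun j hj =>
      hidx _ (FmlPair.vars_subset_of_mem_defs (hκ j hj))
    have ha := hrd _ hα a (.inl rfl)
    have hb := hrd _ hα b (.inr rfl)
    refine ArdModel.iterDiff_eq (N := functionModel X M.Elem z M.bot) (l := k)
      (κ := fun j => v.toModel.idx (κ j)) (fun j hj => ?_) (fun j hj h => ?_) (fun j hj h => ?_)
      (fun j hj t ht => ?_) k le_rfl
    · change (v.toModel.idx (κ (j + 1)) : X).1 ≤ (v.toModel.idx (κ j) : X).1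
      rw [hi j hj.le, hi (j + 1) hj]
      exact chain_le S.added hκ' hj
    · apply Subtype.ext (p := (· ∈ X))
      have h' := congrArg Subtype.val h
      change (v.toModel.idx (κ j) : X).1 = (v.toModel.idx (κ (j + 1)) : X).1 at h'
      rw [hi j hj.le, hi (j + 1) hj] at h'
      exact (hi j hj.le).trans ((chain_repeat S.added hκ' hj h').trans hz.symm)
    · apply Subtype.ext (p := (· ∈ X))
      have hm : M.idx (κ j) ∈ M.points Φ' := chain_mem_points (l := k) hκ' hj
      have h' : extend M Φ Φ' C a (v.toModel.idx (κ j) : X).1 =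
          extend M Φ Φ' C b (v.toModel.idx (κ j) : X).1 := by
        exact (ha _).symm.trans (Eq.trans h (hb _))
      rw [show (v.toModel.idx (κ j) : X).1 = _ from hi j hj, Side.extend_of_mem hm, Side.extend_of_mem hm] at h'
      exact (hi j hj).trans ((chain_eq_zero S.added (fun i hij => hκ' i (hij.trans hj)) h').trans
        hz.symm)
    · have ht' : (v.toModel.idx (κ j) : X).1 < t.1 := ht
      rw [hi j hj] at ht'
      refine (S.extend_agree (fun i hij => hκ i (hij.trans hj)) (hX t.1 t.2) ht').imp
        (fun h => (ha t).trans (h.trans (hb t).symm)) ?_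
      · rintro ⟨i, hij, h⟩
        exact ⟨i, hij, Subtype.ext (p := (· ∈ X)) (h.trans (hi i (by omega)).symm)⟩
  | wr a b i e =>
    have ha := hrd _ hα a (.inl rfl)
    have hb := hrd _ hα b (.inr rfl)
    have hi := hidx i (FmlPair.vars_subset_of_mem_defs hα)
    apply Subtype.ext
    funext t
    refine Eq.trans ?_ (wr_functionModel_apply z M.bot _ _ _ t).symm
    obtain ⟨k, hk⟩ : ∃ k : X, k = v.toModel.idx i := ⟨_, rfl⟩
    simp only [← hk] at hi ⊢
    refine (ha t).trans ?_
    by_cases h : t = k ∧ z ≤ k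
    · refine Eq.trans ?_ (if_pos h).symm
      obtain ⟨rfl, h⟩ := h
      have h' : z.1 ≤ t.1 := h
      rw [hz, hi] at h'
      exact (congrArg _ hi).trans ((S.extend_wr_same hα h').trans (hel e).symm)
    · refine Eq.trans ?_ (if_neg h).symm
      by_cases hti : t = k
      · subst hti
        -- At a negative written index nothing is written, and both arrays read `⊥`.
        have hneg : t < z := not_le.1 fun h' => h ⟨rfl, h'⟩
        exact (ha t).symm.trans (((v.arr a).2 _ hneg).trans ((v.arr b).2 _ hneg).symm)
      · refine (S.extend_wr hα (hX t.1 t.2) fun h' => hti (Subtype.ext ?_)).trans (hb t).symm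
        rw [h', hi]

end Glue
open Classical in
/-- The models of the two sides are amalgamated over the finite set of values of all terms. -/
theorem ardConsistent_of_sides {M : ToEufModel} {A B A' B' : FmlPair} {n : ℕ}
    (hA : A.IsSeparated) (hB : B.IsSeparated)
    (hfinA : A'.idxVars.Finite) (hfinB : B'.idxVars.Finite)
    (harrA : A'.arrVars = A.arrVars) (harrB : B'.arrVars = B.arrVars)
    (SA : Side M A A' B' (commonArrs A B) n) (SB : Side M B B' A' (commonArrs A B) n)
    (hidxA : A.idxVars ⊆ A'.idxVars) (hidxB : B.idxVars ⊆ B'.idxVars)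
    (hM : ∀ φ ∈ A.fmls ∪ B.fmls, M.Holds φ) : ArdConsistent A B := by
  have hpts : ∀ {Φ : FmlPair}, Φ.idxVars.Finite → (M.points Φ).Finite := fun {Φ} h => by
    refine ((h.image M.idxVal).insert M.zero).subset ?_
    rintro _ ⟨x | _, hx, rfl⟩
    · exact .inr ⟨x, hx rfl, rfl⟩
    · exact .inl rfl
  let X : Set M.Index := M.points A' ∪ M.points B'
  have : Finite X := ((hpts hfinA).union (hpts hfinB)).to_subtype
  let z : X := ⟨M.zero, .inl (M.zero_mem_points A')⟩
  have hsymm : ∀ t ∈ X, t ∈ M.points B' ∪ M.points A' := fun t ht => ht.symm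
  -- Giving precedence to `A` is harmless: on `X` the two extensions of a common array coincide.
  let g : ℕ → M.Index → M.Elem := fun x t =>
    if x ∈ A.arrVars then extend M A A' (commonArrs A B) (.var x) t
    else if x ∈ B.arrVars then extend M B B' (commonArrs A B) (.var x) t else M.bot
  have hg : ∀ x, ∀ t : X, t < z → g x t.1 = M.bot := fun x t ht => by
    have ht' : t.1 < M.zero := ht
    simp only [g]
    split_ifs with h1 h2
    · exact SA.extend_of_neg (by rintro _ ⟨⟩; rwa [harrA]) t.2 ht'
    · exact SB.extend_of_neg (by rintro _ ⟨⟩; rwa [harrB]) (hsymm _ t.2) ht'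
    · rfl
  have hgA : ∀ x ∈ A.arrVars, ∀ t, g x t = extend M A A' (commonArrs A B) (.var x) t :=
    fun x hx t => if_pos hx
  have hgB : ∀ x ∈ B.arrVars, ∀ t ∈ X, g x t = extend M B B' (commonArrs A B) (.var x) t := by
    intro x hx t ht
    by_cases hxA : x ∈ A.arrVars
    · have hc : ArrTerm.var x ∈ commonArrs A B := .inl ⟨x, rfl, hxA, hx⟩
      rw [hgA x hxA, SA.extend_common hc ht, SB.extend_common hc (hsymm t ht)]
    · simp only [g, if_neg hxA, if_pos hx]
  let v : (functionModel X M.Elem z M.bot).Assignment :=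
    -- The default `z` is reached only for variables occurring in neither current pair.
    { idxVal := fun x => if h : M.idxVal x ∈ X then (⟨M.idxVal x, h⟩ : X) else z
      elVal := M.elVal
      arrVal := fun x => ⟨fun t => g x t.1, hg x⟩ }
  have hidx : ∀ s, M.idx s ∈ X → (v.toModel.idx s : X).1 = M.idx s := by
    rintro (x | _) hs
    · have : (v.toModel.idx (.var x) : X) = ⟨M.idxVal x, hs⟩ := dif_pos hs
      rw [this]; rfl
    · rfl
  have hel : ∀ e, v.toModel.el e = M.el e := by rintro (x | _) <;> rfl
  have hmemA : ∀ s ∈ A'.instTerms, M.idx s ∈ X := fun s hs => .inl ⟨s, hs, rfl⟩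
  have hmemB : ∀ s ∈ B'.instTerms, M.idx s ∈ X := fun s hs => .inr ⟨s, hs, rfl⟩
  have hidxA' : ∀ s ∈ A.instTerms, (v.toModel.idx s : X).1 = M.idx s := fun s hs =>
    hidx s (hmemA s (hs.trans hidxA))
  have hidxB' : ∀ s ∈ B.instTerms, (v.toModel.idx s : X).1 = M.idx s := fun s hs =>
    hidx s (hmemB s (hs.trans hidxB))
  have heps : ∀ t ∈ X, M.func .eps t = M.bot := by
    rintro _ (⟨s, hs, rfl⟩ | ⟨s, hs, rfl⟩)
    · exact SA.added _ (.eps s hs)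
    · exact SB.added _ (.eps s hs)
  have hdefsA : ∀ α ∈ A.defs, ∀ a ∈ α.arrs, ∀ t : X,
      (v.arr a).1 t = extend M A A' (commonArrs A B) a t.1 := by
    rintro α hα (x | _) ha t
    · exact hgA x (FmlPair.mem_arrVars_of_mem_defs hα ha) t.1
    -- This is why `ε` counts as common once it occurs in an equality: its extension must be `⊥` on
    -- all of `X`, including terms of the other side.
    · rw [SA.extend_common (.inr ⟨rfl, α, .inl hα, ha⟩) t.2, heps t.1 t.2]; rfl
  have hdefsB : ∀ α ∈ B.defs, ∀ a ∈ α.arrs, ∀ t : X,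
      (v.arr a).1 t = extend M B B' (commonArrs A B) a t.1 := by
    rintro α hα (x | _) ha t
    · exact hgB x (FmlPair.mem_arrVars_of_mem_defs hα ha) t.1 t.2
    · rw [SB.extend_common (.inr ⟨rfl, α, .inr hα, ha⟩) (hsymm _ t.2), heps t.1 t.2]; rfl
  refine ⟨functionModel X M.Elem z M.bot, v, ?_, ?_⟩
  · rintro α (hα | hα)
    · exact SA.holdsDef z rfl v (fun _ h => h) hA hidxA' hel hdefsA α hα
    · exact SB.holdsDef z rfl v hsymm hB hidxB' hel hdefsB α hα
  · rintro φ (hφ | hφ)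
    · refine (holds_iff_of_agree (M := M) (N := v.toModel) (Φ := A) (fun t : X => t.1)
        (fun _ _ => Iff.rfl) Subtype.val_injective hidxA' id Function.injective_id hel φ
        (FmlPair.vars_subset_of_mem_fmls hφ) ?_).2 (hM φ (.inl hφ))
      rintro (x | _) ha s hs
      · refine (hgA x (.inr ⟨φ, hφ, ha⟩) _).trans ?_
        have : (v.toModel.idx s : X).1 = M.idx s := hidxA' s hs
        rw [this, Side.extend_of_mem ⟨s, hs.trans hidxA, rfl⟩]
      · exact (heps _ (hmemA s (hs.trans hidxA))).symm
    · refine (holds_iff_of_agree (M := M) (N := v.toModel) (Φ := B) (fun t : X => t.1)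
        (fun _ _ => Iff.rfl) Subtype.val_injective hidxB' id Function.injective_id hel φ
        (FmlPair.vars_subset_of_mem_fmls hφ) ?_).2 (hM φ (.inr hφ))
      rintro (x | _) ha s hs
      · refine (hgB x (.inr ⟨φ, hφ, ha⟩) _ (v.toModel.idx s : X).2).trans ?_
        have : (v.toModel.idx s : X).1 = M.idx s := hidxB' s hs
        rw [this, Side.extend_of_mem ⟨s, hs.trans hidxB, rfl⟩]
      · exact (heps _ (hmemB s (hs.trans hidxB))).symm

/-! ## Occurrences in instantiations -/

@[simp] theorem IdxTerm.vars_zero : IdxTerm.zero.vars = ∅ := rfl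

namespace Fml

@[simp] theorem idxVars_imp (φ ψ : Fml) : (imp φ ψ).idxVars = φ.idxVars ∪ ψ.idxVars := rfl
@[simp] theorem idxVars_or (φ ψ : Fml) : (or φ ψ).idxVars = φ.idxVars ∪ ψ.idxVars := rfl
@[simp] theorem idxVars_idxLt (s t : IdxTerm) : (idxLt s t).idxVars = s.vars ∪ t.vars := by
  simp [idxLt, idxVars]
@[simp] theorem arrs_imp (φ ψ : Fml) : (imp φ ψ).arrs = φ.arrs ∪ ψ.arrs := rfl
@[simp] theorem arrs_or (φ ψ : Fml) : (or φ ψ).arrs = φ.arrs ∪ ψ.arrs := rfl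
@[simp] theorem arrs_idxLt (s t : IdxTerm) : (idxLt s t).arrs = ∅ := by simp [idxLt, arrs]

end Fml

/-- All index variables of `φ` are in `V` and all array variables of `φ` are in `W`. -/
def Fml.Within (V W : Set ℕ) (φ : Fml) : Prop :=
  φ.idxVars ⊆ V ∧ ∀ x, ArrTerm.var x ∈ φ.arrs → x ∈ W

section Within

variable {V W : Set ℕ} {a b : ArrTerm}

theorem within_diffMono {ks : List IdxTerm} (h : ∀ k ∈ ks, k.vars ⊆ V) :
    (diffMono ks).Within V W := by
  induction ks with
  | nil => simp [diffMono, Fml.Within, Fml.idxVars, Fml.arrs]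
  | cons k ks ih =>
    cases ks with
    | nil => simpa [diffMono, Fml.Within, Fml.idxVars, Fml.arrs, IdxTerm.vars] using h
    | cons k' ks =>
      have := ih fun j hj => h j (.tail _ hj)
      have h1 := h k (by simp)
      have h2 := h k' (by simp)
      simp_all [diffMono, Fml.Within, Fml.idxVars, Fml.arrs]

theorem within_diffRepeat {ks : List IdxTerm} (h : ∀ k ∈ ks, k.vars ⊆ V) :
    (diffRepeat ks).Within V W := by
  induction ks with
  | nil => simp [diffRepeat, Fml.Within, Fml.idxVars, Fml.arrs]
  | cons k ks ih =>
    cases ks with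
    | nil => simp [diffRepeat, Fml.Within, Fml.idxVars, Fml.arrs]
    | cons k' ks =>
      have := ih fun j hj => h j (.tail _ hj)
      have h1 := h k (by simp)
      have h2 := h k' (by simp)
      simp_all [diffRepeat, Fml.Within, Fml.idxVars, Fml.arrs, IdxTerm.vars]

variable (ha : ∀ x, a = .var x → x ∈ W) (hb : ∀ x, b = .var x → x ∈ W)

include ha hb

theorem within_diffNe {ks : List IdxTerm} (h : ∀ k ∈ ks, k.vars ⊆ V) :
    (diffNe a b ks).Within V W := by
  induction ks with
  | nil => simp [diffNe, Fml.Within, Fml.idxVars, Fml.arrs]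
  | cons k ks ih =>
    cases ks with
    | nil => simp [diffNe, Fml.Within, Fml.idxVars, Fml.arrs]
    | cons k' ks =>
      obtain ⟨i1, i2⟩ := ih fun j hj => h j (.tail _ hj)
      have h1 := h k (by simp)
      have h2 := h k' (by simp)
      refine ⟨by simp_all [diffNe, Fml.idxVars], fun x hx => ?_⟩
      simp only [diffNe, Fml.arrs, Fml.arrs_imp, Fml.arrs_idxLt, Set.empty_union,
        Set.mem_union, Set.mem_insert_iff, Set.mem_singleton_iff] at hx
      rcases hx with (h | h) | h
      exacts [ha x h.symm, hb x h.symm, i2 x h]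

theorem within_diffZero {ks : List IdxTerm} (h : ∀ k ∈ ks, k.vars ⊆ V) :
    (diffZero a b ks).Within V W := by
  induction ks with
  | nil => simp [diffZero, Fml.bigAnd, Fml.Within, Fml.idxVars, Fml.arrs]
  | cons k ks ih =>
    obtain ⟨i1, i2⟩ := ih fun j hj => h j (.tail _ hj)
    have h1 := h k (by simp)
    refine ⟨?_, fun x hx => ?_⟩
    · simp only [diffZero] at i1
      simp_all [diffZero, Fml.bigAnd, Fml.idxVars, IdxTerm.vars]
    · simp only [diffZero, List.map_cons, Fml.bigAnd, Fml.arrs, Fml.arrs_imp, Set.union_empty,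
        Set.mem_union, Set.mem_insert_iff, Set.mem_singleton_iff] at hx
      rcases hx with (h | h) | h
      exacts [ha x h.symm, hb x h.symm, i2 x h]

theorem within_diffInst {js : List IdxTerm} {k t : IdxTerm} (h : ∀ j ∈ js, j.vars ⊆ V)
    (hk : k.vars ⊆ V) (ht : t.vars ⊆ V) : (diffInst a b js k t).Within V W := by
  have key : (Fml.bigOr (js.map fun j => Fml.idxEq t j)).idxVars ⊆ V ∧
      (Fml.bigOr (js.map fun j => Fml.idxEq t j)).arrs = ∅ := by
    induction js with
    | nil => simp [Fml.bigOr, Fml.idxVars, Fml.arrs]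
    | cons j js ih =>
      have := ih fun j hj => h j (.tail _ hj)
      have h1 := h j (by simp)
      simp_all [Fml.bigOr, Fml.idxVars, Fml.arrs]
  refine ⟨by simp_all [diffInst, Fml.idxVars], fun x hx => ?_⟩
  simp only [diffInst, Fml.arrs, Fml.arrs_imp, Fml.arrs_or, Fml.arrs_idxLt, Set.empty_union, key.2,
    Set.union_empty, Set.mem_insert_iff, Set.mem_singleton_iff] at hx
  rcases hx with h | h
  exacts [ha x h.symm, hb x h.symm]

end Within

namespace FmlPair

variable {Φ : FmlPair}

theorem HasDiffs.vars_subset {a b : ArrTerm} {ks : List IdxTerm} (h : Φ.HasDiffs a b ks) :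
    ∀ k ∈ ks, k.vars ⊆ Φ.idxVars := fun k hk => by
  obtain ⟨j, hj, rfl⟩ := List.getElem_of_mem hk
  exact vars_subset_of_mem_defs (h.2 j hj)

theorem HasDiffs.mem_arrVars {a b : ArrTerm} {ks : List IdxTerm} (h : Φ.HasDiffs a b ks) :
    (∀ x, a = .var x → x ∈ Φ.arrVars) ∧ ∀ x, b = .var x → x ∈ Φ.arrVars := by
  have hd := h.2 0 (List.length_pos_iff.2 h.1)
  exact ⟨fun x hx => mem_arrVars_of_mem_defs hd (hx ▸ .inl rfl),
    fun x hx => mem_arrVars_of_mem_defs hd (hx ▸ .inr rfl)⟩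

/-- No new symbols enter, so the instantiating terms stay the same and instantiation is idempotent.
-/
theorem Added.within {φ : Fml} (h : Φ.Added φ) : φ.Within Φ.idxVars Φ.arrVars := by
  cases h with
  | eps t ht => exact ⟨ht, by rintro x ⟨⟩⟩
  | neg x hx t ht =>
    refine ⟨?_, fun y hy => ?_⟩
    · have : t.vars ⊆ Φ.idxVars := ht
      simp [Fml.idxVars, this]
    · simp only [Fml.arrs_imp, Fml.arrs_idxLt, Set.empty_union, Fml.arrs,
        Set.mem_singleton_iff] at hy
      cases hy
      exact hx
  | wrGround a b i e h =>
    have hi : i.vars ⊆ Φ.idxVars := vars_subset_of_mem_defs h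
    refine ⟨by simp [MaxDiff.wrGround, Fml.idxVars, hi], fun y hy => ?_⟩
    simp only [MaxDiff.wrGround, Fml.arrs_imp, Set.empty_union, Fml.arrs] at hy
    exact mem_arrVars_of_mem_defs h (.inl (by simpa using hy))
  | wrInst a b i e h t ht =>
    have hi : i.vars ⊆ Φ.idxVars := vars_subset_of_mem_defs h
    have ht : t.vars ⊆ Φ.idxVars := ht
    refine ⟨by simp [MaxDiff.wrInst, Fml.idxVars, hi, ht], fun y hy => ?_⟩
    simp only [MaxDiff.wrInst, Fml.arrs_imp, Set.empty_union, Fml.arrs] at hy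
    exact mem_arrVars_of_mem_defs h hy
  | diffMono a b ks h => exact within_diffMono h.vars_subset
  | diffNe a b ks h => exact within_diffNe h.mem_arrVars.1 h.mem_arrVars.2 h.vars_subset
  | diffRepeat a b ks h => exact within_diffRepeat h.vars_subset
  | diffZero a b ks h => exact within_diffZero h.mem_arrVars.1 h.mem_arrVars.2 h.vars_subset
  | diffInst a b js k h t ht =>
    exact within_diffInst h.mem_arrVars.1 h.mem_arrVars.2
      (fun j hj => h.vars_subset j (List.mem_append_left _ hj)) (h.vars_subset k (by simp)) ht

theorem idxVars_mono {Φ Ψ : FmlPair} (hd : Φ.defs ⊆ Ψ.defs) (hf : Φ.fmls ⊆ Ψ.fmls) :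
    Φ.idxVars ⊆ Ψ.idxVars :=
  Set.union_subset_union (Set.biUnion_mono hd fun _ _ => le_rfl)
    (Set.biUnion_mono hf fun _ _ => le_rfl)

theorem arrVars_mono {Φ Ψ : FmlPair} (hd : Φ.defs ⊆ Ψ.defs) (hf : Φ.fmls ⊆ Ψ.fmls) :
    Φ.arrVars ⊆ Ψ.arrVars := fun _ hx =>
  hx.imp (fun ⟨α, hα, h⟩ => ⟨α, hd hα, h⟩) fun ⟨φ, hφ, h⟩ => ⟨φ, hf hφ, h⟩

theorem idxVars_instantiate (Φ : FmlPair) : Φ.instantiate.idxVars = Φ.idxVars := by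
  refine Set.Subset.antisymm (Set.union_subset Set.subset_union_left ?_)
    (idxVars_mono (Ψ := Φ.instantiate) le_rfl Set.subset_union_left)
  rw [Set.iUnion₂_subset_iff]
  rintro φ (hφ | hφ)
  · exact vars_subset_of_mem_fmls hφ
  · exact hφ.within.1

theorem arrVars_instantiate (Φ : FmlPair) : Φ.instantiate.arrVars = Φ.arrVars := by
  refine Set.Subset.antisymm ?_ (arrVars_mono (Ψ := Φ.instantiate) le_rfl Set.subset_union_left)
  rintro x (h | ⟨φ, hφ | hφ, h⟩)
  · exact .inl h
  · exact .inr ⟨φ, hφ, h⟩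
  · exact hφ.within.2 x h

theorem Added.of_instantiate {φ : Fml} (h : Φ.instantiate.Added φ) : Φ.Added φ := by
  have hi : Φ.instantiate.instTerms = Φ.instTerms := by
    simp only [instTerms, idxVars_instantiate]
  cases h with
  | eps t ht => exact .eps t (hi ▸ ht)
  | neg x hx t ht => exact .neg x (Φ.arrVars_instantiate ▸ hx) t (hi ▸ ht)
  | wrGround a b i e h => exact .wrGround a b i e h
  | wrInst a b i e h t ht => exact Added.wrInst (Φ := Φ) a b i e h t (hi ▸ ht)
  | diffMono a b ks h => exact .diffMono a b ks h
  | diffNe a b ks h => exact .diffNe a b ks h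
  | diffRepeat a b ks h => exact .diffRepeat a b ks h
  | diffZero a b ks h => exact .diffZero a b ks h
  | diffInst a b js k h t ht => exact Added.diffInst (Φ := Φ) a b js k h t (hi ▸ ht)

theorem isInstantiated_instantiate (Φ : FmlPair) : Φ.instantiate.IsInstantiated := by
  refine FmlPair.ext rfl (Set.union_eq_self_of_subset_right fun φ hφ => .inr ?_)
  exact Added.of_instantiate hφ

theorem IsInstantiated.mem_of_added (h : Φ.IsInstantiated) {φ : Fml} (hφ : Φ.Added φ) :
    φ ∈ Φ.fmls := by
  rw [← h]; exact .inr hφ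

theorem finite_fml_idxVars (φ : Fml) : φ.idxVars.Finite := by
  have ht : ∀ t : IdxTerm, t.vars.Finite := by rintro (x | _) <;> simp [IdxTerm.vars]
  induction φ <;> simp_all [Fml.idxVars]

theorem IsFinite.finite_idxVars (h : Φ.IsFinite) : Φ.idxVars.Finite := by
  refine (h.1.biUnion fun α _ => ?_).union (h.2.biUnion fun φ _ => finite_fml_idxVars φ)
  rcases α with ⟨_, _, _, x | _⟩ | ⟨_, _, x | _, _⟩ <;> simp [DefAtom.idxVars, IdxTerm.vars]

theorem finite_fml_arrs (φ : Fml) : φ.arrs.Finite := by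
  induction φ <;> simp_all [Fml.arrs]

theorem IsFinite.finite_arrVars (h : Φ.IsFinite) : Φ.arrVars.Finite := by
  have hfin : ((⋃ α ∈ Φ.defs, α.arrs) ∪ ⋃ φ ∈ Φ.fmls, φ.arrs).Finite := by
    refine (h.1.biUnion fun α _ => ?_).union (h.2.biUnion fun φ _ => finite_fml_arrs φ)
    cases α <;> simp [DefAtom.arrs]
  refine (hfin.preimage (f := ArrTerm.var) (fun _ _ _ _ h => by cases h; rfl)).subset ?_
  rintro x (⟨α, hα, h⟩ | ⟨φ, hφ, h⟩)
  · exact .inl (Set.mem_biUnion hα h)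
  · exact .inr (Set.mem_biUnion hφ h)

end FmlPair

theorem finite_commonArrs {A B : FmlPair} (hA : A.IsFinite) : (commonArrs A B).Finite := by
  refine ((hA.finite_arrVars.image ArrTerm.var).insert .eps).subset ?_
  rintro c (⟨x, rfl, hx, _⟩ | ⟨rfl, _⟩)
  · exact .inr ⟨x, hx, rfl⟩
  · exact .inl rfl

/-! ## Invariants of the loop -/

theorem mem_arrVars_of_mem_commonArrs {A B : FmlPair} {c : ArrTerm} (hc : c ∈ commonArrs A B)
    (x : ℕ) (hx : c = .var x) : x ∈ A.arrVars ∧ x ∈ B.arrVars := by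
  subst hx
  obtain ⟨y, hy, h⟩ | ⟨h, _⟩ := hc
  · cases hy; exact h
  · cases h

theorem FmlPair.arrVars_addDiff {Φ : FmlPair} {c d : ArrTerm}
    (hc : ∀ x, c = .var x → x ∈ Φ.arrVars) (hd : ∀ x, d = .var x → x ∈ Φ.arrVars) (k x : ℕ) :
    (Φ.addDiff k c d x).arrVars = Φ.arrVars := by
  refine Set.Subset.antisymm ?_
    (FmlPair.arrVars_mono (Ψ := Φ.addDiff k c d x) (Set.subset_insert _ _) le_rfl)
  rintro y (⟨α, rfl | hα, h⟩ | h)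
  · exact h.elim (fun h => hc y h.symm) fun h => hd y h.symm
  · exact .inl ⟨α, hα, h⟩
  · exact .inr h

theorem FmlPair.finite_idxVars_addDiff {Φ : FmlPair} (h : Φ.idxVars.Finite) (k : ℕ)
    (c d : ArrTerm) (x : ℕ) : (Φ.addDiff k c d x).idxVars.Finite := by
  refine (h.insert x).subset (Set.union_subset ?_ ?_)
  · rw [Set.iUnion₂_subset_iff]
    rintro α (rfl | hα) y hy
    · exact .inl hy
    · exact .inr (FmlPair.vars_subset_of_mem_defs hα hy)
  · exact fun y hy => .inr (.inr hy)

/-- The new equality mentions only arrays that are already common, `ε` included; so `m` is constant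
along a run. -/
theorem commonArrs_step {A B : FmlPair} {c d : ArrTerm} (hc : c ∈ commonArrs A B)
    (hd : d ∈ commonArrs A B) (k x : ℕ) :
    commonArrs (A.addDiff k c d x).instantiate (B.addDiff k c d x).instantiate =
      commonArrs A B := by
  have hA : (A.addDiff k c d x).instantiate.arrVars = A.arrVars := by
    rw [FmlPair.arrVars_instantiate, FmlPair.arrVars_addDiff
      (fun y hy => (mem_arrVars_of_mem_commonArrs hc y hy).1)
      (fun y hy => (mem_arrVars_of_mem_commonArrs hd y hy).1)]
  have hB : (B.addDiff k c d x).instantiate.arrVars = B.arrVars := by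
    rw [FmlPair.arrVars_instantiate, FmlPair.arrVars_addDiff
      (fun y hy => (mem_arrVars_of_mem_commonArrs hc y hy).2)
      (fun y hy => (mem_arrVars_of_mem_commonArrs hd y hy).2)]
  have new : ArrTerm.eps ∈ (DefAtom.diff k c d (.var x)).arrs →
      ArrTerm.eps ∈ commonArrs A B := by
    rintro (h | h)
    · exact h ▸ hc
    · exact Set.mem_singleton_iff.1 h ▸ hd
  ext e
  constructor
  · rintro (⟨y, hy, h⟩ | ⟨rfl, α, (rfl | hα) | (rfl | hα), h⟩)
    · rw [hA, hB] at h; exact .inl ⟨y, hy, h⟩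
    · exact new h
    · exact .inr ⟨rfl, α, .inl hα, h⟩
    · exact new h
    · exact .inr ⟨rfl, α, .inr hα, h⟩
  · rintro (⟨y, hy, h⟩ | ⟨rfl, α, hα, h⟩)
    · rw [← hA, ← hB] at h; exact .inl ⟨y, hy, h⟩
    · exact .inr ⟨rfl, α, hα.imp (fun h => .inr h) fun h => .inr h, h⟩

/-- What every execution of the loop preserves. -/
structure RunInvariant (A B : FmlPair) (ps : List (ArrTerm × ArrTerm)) (A' B' : FmlPair) :
    Prop where
  defsA : A.defs ⊆ A'.defs
  defsB : B.defs ⊆ B'.defs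
  fmlsA : A.fmls ⊆ A'.fmls
  fmlsB : B.fmls ⊆ B'.fmls
  instA : A'.IsInstantiated
  instB : B'.IsInstantiated
  arrA : A'.arrVars = A.arrVars
  arrB : B'.arrVars = B.arrVars
  finite_defs : A'.defs.Finite
  finiteA : A'.idxVars.Finite
  finiteB : B'.idxVars.Finite
  common : commonArrs A' B' = commonArrs A B
  commonDiff : ∀ c d, ∀ l < ps.count (c, d), CommonDiff A' B' l c d
  handled : ∀ p ∈ ps, p.1 ∈ commonArrs A B ∧ p.2 ∈ commonArrs A B ∧ p.1 ≠ p.2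

theorem LoopRun.invariant {A B A' B' : FmlPair} {ps : List (ArrTerm × ArrTerm)}
    (hA : A.IsFinite) (hB : B.IsFinite) (hAi : A.IsInstantiated) (hBi : B.IsInstantiated)
    (h : LoopRun A B ps A' B') : RunInvariant A B ps A' B' := by
  induction h with
  | start =>
    exact ⟨le_rfl, le_rfl, le_rfl, le_rfl, hAi, hBi, rfl, rfl, hA.1, hA.finite_idxVars,
      hB.finite_idxVars, rfl, fun c d l hl => by simp at hl, fun p hp => by simp at hp⟩
  | @step ps A₁ B₁ A₂ B₂ p _ hs I =>
    obtain ⟨-, h1, h2, hne, k, x, hk, hl, -, -, rfl, rfl⟩ := hs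
    have hcommon := commonArrs_step h1 h2 k x
    rw [I.common] at h1 h2 hcommon
    have hmono : ∀ {l c d}, CommonDiff A₁ B₁ l c d →
        CommonDiff (A₁.addDiff k p.1 p.2 x).instantiate (B₁.addDiff k p.1 p.2 x).instantiate
          l c d := fun ⟨i, h, h'⟩ => ⟨i, .inr h, .inr h'⟩
    have hc := mem_arrVars_of_mem_commonArrs h1
    have hd := mem_arrVars_of_mem_commonArrs h2
    refine
      { defsA := I.defsA.trans (Set.subset_insert _ _)
        defsB := I.defsB.trans (Set.subset_insert _ _)
        fmlsA := I.fmlsA.trans Set.subset_union_left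
        fmlsB := I.fmlsB.trans Set.subset_union_left
        instA := FmlPair.isInstantiated_instantiate _
        instB := FmlPair.isInstantiated_instantiate _
        arrA := ?_
        arrB := ?_
        finite_defs := I.finite_defs.insert _
        finiteA := ?_
        finiteB := ?_
        common := hcommon
        commonDiff := ?_
        handled := ?_ }
    · rw [FmlPair.arrVars_instantiate, FmlPair.arrVars_addDiff, I.arrA] <;> rw [I.arrA]
      exacts [fun y hy => (hc y hy).1, fun y hy => (hd y hy).1]
    · rw [FmlPair.arrVars_instantiate, FmlPair.arrVars_addDiff, I.arrB] <;> rw [I.arrB]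
      exacts [fun y hy => (hc y hy).2, fun y hy => (hd y hy).2]
    · rw [FmlPair.idxVars_instantiate]
      exact FmlPair.finite_idxVars_addDiff I.finiteA _ _ _ _
    · rw [FmlPair.idxVars_instantiate]
      exact FmlPair.finite_idxVars_addDiff I.finiteB _ _ _ _
    · intro c d l hlt
      by_cases hlt' : l < ps.count (c, d)
      · exact hmono (I.commonDiff c d l hlt')
      · have hp : p = (c, d) := by
          by_contra hp
          rw [List.count_append, List.count_singleton, if_neg (by simpa using hp)] at hlt
          exact hlt' (by simpa using hlt)
        subst hp
        rw [List.count_append, List.count_singleton, if_pos (by simp)] at hlt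
        -- The first level not yet shared may exceed the number of times the pair was handled, since
        -- the initial pairs may already share diffs.
        have hck : ps.count (c, d) ≤ k := not_lt.1 fun h => hk (I.commonDiff c d k h)
        rcases (show l ≤ k by omega).lt_or_eq with h | rfl
        · exact hmono (hl l h)
        · exact ⟨.var x, .inl rfl, .inl rfl⟩
    · intro q hq
      rcases List.mem_append.1 hq with hq | hq
      · exact I.handled q hq
      · rw [List.mem_singleton.1 hq]; exact ⟨h1, h2, hne⟩

/-- If all the iterated diffs of common arrays up to one more than the number of index variables
are shared, then a model of the instances gives a model of the initial pairs. -/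
theorem RunInvariant.ardConsistent {A B A' B' : FmlPair} {ps : List (ArrTerm × ArrTerm)}
    (I : RunInvariant A B ps A' B') (hA : A.IsSeparated) (hB : B.IsSeparated)
    (hAfin : A.IsFinite) (hBfin : B.IsFinite)
    (hcount : ∀ c ∈ commonArrs A B, ∀ d ∈ commonArrs A B, c ≠ d →
      (A.idxVars ∪ B.idxVars).ncard + 1 ≤ ps.count (c, d) ∨
      (A.idxVars ∪ B.idxVars).ncard + 1 ≤ ps.count (d, c))
    (hcons : ToEufConsistent A' B') : ArdConsistent A B := by
  obtain ⟨M, hM⟩ := hcons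
  have hfin := hAfin.finite_idxVars.union hBfin.finite_idxVars
  have hMA : ∀ φ, A'.Added φ → M.Holds φ := fun φ h => hM φ (.inl (I.instA.mem_of_added h))
  have hMB : ∀ φ, B'.Added φ → M.Holds φ := fun φ h => hM φ (.inr (I.instB.mem_of_added h))
  have hdiff : ∀ c ∈ commonArrs A B, ∀ d ∈ commonArrs A B, c ≠ d →
      (∀ l < (A.idxVars ∪ B.idxVars).ncard + 1, CommonDiff A' B' l c d) ∨
      ∀ l < (A.idxVars ∪ B.idxVars).ncard + 1, CommonDiff A' B' l d c := fun c hc d hd hcd =>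
    (hcount c hc d hd hcd).imp (fun h l hl => I.commonDiff c d l (hl.trans_le h))
      fun h l hl => I.commonDiff d c l (hl.trans_le h)
  refine ardConsistent_of_sides (n := (A.idxVars ∪ B.idxVars).ncard) hA hB I.finiteA I.finiteB
    I.arrA I.arrB
    { added := hMA
      added_companion := hMB
      defs_subset := I.defsA
      arr_mem := fun c hc x hx => I.arrB ▸ (mem_arrVars_of_mem_commonArrs hc x hx).2
      finite := hAfin.finite_idxVars
      ncard_le := Set.ncard_le_ncard Set.subset_union_left hfin
      common := hdiff }
    { added := hMB
      added_companion := hMA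
      defs_subset := I.defsB
      arr_mem := fun c hc x hx => I.arrA ▸ (mem_arrVars_of_mem_commonArrs hc x hx).1
      finite := hBfin.finite_idxVars
      ncard_le := Set.ncard_le_ncard Set.subset_union_right hfin
      common := fun c hc d hd hcd => (hdiff c hc d hd hcd).imp
        (fun h l hl => (h l hl).imp fun _ => And.symm)
        fun h l hl => (h l hl).imp fun _ => And.symm }
    (FmlPair.idxVars_mono I.defsA I.fmlsA) (FmlPair.idxVars_mono I.defsB I.fmlsB)
    fun φ hφ => hM φ (hφ.imp (fun h => I.fmlsA h) fun h => I.fmlsB h)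

/-! ## Counting the steps -/

theorem timesHandled_comm (ps : List (ArrTerm × ArrTerm)) (c d : ArrTerm) :
    timesHandled ps c d = timesHandled ps d c := Nat.add_comm _ _

theorem count_map_mk (ps : List (ArrTerm × ArrTerm)) {c d : ArrTerm} (hcd : c ≠ d) :
    (ps.map fun p => s(p.1, p.2)).count s(c, d) = timesHandled ps c d := by
  induction ps with
  | nil => rfl
  | cons p ps ih =>
    obtain ⟨a, b⟩ := p
    simp only [timesHandled, List.map_cons, List.count_cons, ih] at ih ⊢
    simp only [beq_iff_eq, Sym2.eq_iff, Prod.mk.injEq]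
    by_cases h1 : a = c ∧ b = d
    · obtain ⟨rfl, rfl⟩ := h1
      simp only [and_self, true_or, if_true]
      rw [if_neg fun h => hcd h.1]
      omega
    · by_cases h2 : a = d ∧ b = c
      · simp [h2, hcd, hcd.symm]; omega
      · simp only [h1, h2, or_false, if_false]; omega

theorem Fair.of_append {C : Set ArrTerm} {ps qs : List (ArrTerm × ArrTerm)}
    (h : Fair C (ps ++ qs)) : Fair C ps :=
  ⟨fun c d hcd hdc => h.1 c d (List.mem_append_left _ hcd) (List.mem_append_left _ hdc),
    fun rs hrs => h.2 rs (hrs.trans (List.prefix_append _ _))⟩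

/-- A fair sequence that is long enough handles every pair often. -/
theorem Fair.lt_timesHandled {C : Set ArrTerm} (hC : C.Finite) {ps : List (ArrTerm × ArrTerm)}
    (h : Fair C ps) (hps : ∀ p ∈ ps, p.1 ∈ C ∧ p.2 ∈ C ∧ p.1 ≠ p.2) {n : ℕ}
    (hlen : (C.ncard ^ 2 - C.ncard) / 2 * (n + 1) ≤ ps.length) {c d : ArrTerm} (hc : c ∈ C)
    (hd : d ∈ C) (hcd : c ≠ d) : n < timesHandled ps c d := by
  by_contra hlt
  lift C to Finset ArrTerm using hC
  -- If one unordered pair is handled at most `n` times, fairness caps all others at `n + 1`;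
  -- summing over `S` makes the list shorter than `|S| · (n + 1)`.
  set S : Finset (Sym2 ArrTerm) := C.offDiag.image fun p => s(p.1, p.2) with hS
  have hcard : S.card = (C.card ^ 2 - C.card) / 2 := by
    rw [hS, show (fun p : ArrTerm × ArrTerm => s(p.1, p.2)) = Function.uncurry Sym2.mk from rfl,
      Sym2.card_image_offDiag, Nat.choose_two_right, Nat.mul_sub_one, sq]
  have hmem : s(c, d) ∈ S := Finset.mem_image.2 ⟨(c, d), by simp_all, rfl⟩
  have hsum : ∑ z ∈ S, (ps.map fun p => s(p.1, p.2)).count z = ps.length := by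
    rw [← List.length_map (fun p : ArrTerm × ArrTerm => s(p.1, p.2)), ← Multiset.coe_card,
      ← Multiset.sum_count_eq_card (s := S)]
    · simp
    · intro z hz
      obtain ⟨p, hp, rfl⟩ := List.mem_map.1 (Multiset.mem_coe.1 hz)
      exact Finset.mem_image.2 ⟨p, Finset.mem_offDiag.2 (hps p hp), rfl⟩
  have hle : ∀ z ∈ S, (ps.map fun p => s(p.1, p.2)).count z ≤ n + 1 := by
    intro z hz
    obtain ⟨p, hp, rfl⟩ := Finset.mem_image.1 hz
    obtain ⟨h1, h2, h3⟩ := Finset.mem_offDiag.1 hp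
    rw [count_map_mk ps h3]
    have := h.2 ps List.prefix_rfl p.1 h1 p.2 h2 h3 c hc d hd hcd
    omega
  have hlt' := Finset.sum_lt_sum hle ⟨s(c, d), hmem, by rw [count_map_mk ps hcd]; omega⟩
  rw [hsum, Finset.sum_const, smul_eq_mul, hcard] at hlt'
  rw [Set.ncard_coe_finset] at hlen
  omega

/-- As long as there are two distinct members, a fair sequence can be continued fairly. -/
theorem Fair.exists_extension {C : Set ArrTerm} {ps : List (ArrTerm × ArrTerm)}
    (h : Fair C ps) (hC : ∃ c ∈ C, ∃ d ∈ C, c ≠ d) :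
    ∃ p : ArrTerm × ArrTerm, p.1 ∈ C ∧ p.2 ∈ C ∧ p.1 ≠ p.2 ∧ Fair C (ps ++ [p]) := by
  obtain ⟨c, hc, d, hd, hcd, hmin⟩ : ∃ c ∈ C, ∃ d ∈ C, c ≠ d ∧
      ∀ c' ∈ C, ∀ d' ∈ C, c' ≠ d' → timesHandled ps c d ≤ timesHandled ps c' d' := by
    obtain ⟨c, hc, d, hd, hcd⟩ := hC
    obtain ⟨p, ⟨h1, h2, h3⟩, hp⟩ := exists_minimalFor_of_wellFoundedLT
      (fun p : ArrTerm × ArrTerm => p.1 ∈ C ∧ p.2 ∈ C ∧ p.1 ≠ p.2)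
      (fun p => timesHandled ps p.1 p.2) ⟨(c, d), hc, hd, hcd⟩
    refine ⟨p.1, h1, p.2, h2, h3, fun c' hc' d' hd' hcd' => ?_⟩
    rcases le_total (timesHandled ps p.1 p.2) (timesHandled ps c' d') with h | h
    · exact h
    · exact hp (j := (c', d')) ⟨hc', hd', hcd'⟩ h
  -- The least handled pair is taken next, in the order in which it was handled before, if at all.
  wlog hdc : (d, c) ∉ ps generalizing c d
  · refine this d hd c hc hcd.symm (fun c' hc' d' hd' h' => ?_)
      fun h' => h.1 c d h' (not_not.1 hdc)
    rw [timesHandled_comm]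
    exact hmin c' hc' d' hd' h'
  refine ⟨(c, d), hc, hd, hcd, fun a b hab hba => ?_, fun qs hqs => ?_⟩
  · simp only [List.mem_append, List.mem_singleton, Prod.mk.injEq] at hab hba
    rcases hab with hab | ⟨rfl, rfl⟩
    · rcases hba with hba | ⟨h1, h2⟩
      · exact h.1 a b hab hba
      · exact hdc (h1 ▸ h2 ▸ hab)
    · rcases hba with hba | ⟨h1, -⟩
      · exact hdc hba
      · exact hcd h1.symm
  · rcases List.prefix_concat_iff.1 hqs with rfl | hqs
    · intro c₁ h₁ c₂ h₂ h₁₂ d₁ h₃ d₂ h₄ h₃₄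
      have hle : timesHandled ps d₁ d₂ ≤ timesHandled (ps ++ [(c, d)]) d₁ d₂ := by
        simp only [timesHandled, List.count_append]; omega
      have e1 := h.2 ps List.prefix_rfl c₁ h₁ c₂ h₂ h₁₂ d₁ h₃ d₂ h₄ h₃₄
      have e2 := hmin d₁ h₃ d₂ h₄ h₃₄
      have e3 : timesHandled (ps ++ [(c, d)]) c₁ c₂ ≤ timesHandled ps c₁ c₂ ∨
          timesHandled (ps ++ [(c, d)]) c₁ c₂ ≤ timesHandled ps c d + 1 := by
        simp only [timesHandled, List.count_append, List.count_singleton, beq_iff_eq,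
          Prod.mk.injEq]
        by_cases hA : c = c₁ ∧ d = c₂
        · obtain ⟨rfl, rfl⟩ := hA
          right
          rw [if_pos ⟨rfl, rfl⟩, if_neg fun h => hcd h.1]; omega
        · by_cases hB : c = c₂ ∧ d = c₁
          · obtain ⟨rfl, rfl⟩ := hB
            right
            rw [if_neg hA, if_pos ⟨rfl, rfl⟩]; omega
          · left
            rw [if_neg hA, if_neg hB]; omega
      omega
    · exact h.2 qs hqs

/-- A pair of distinct common arrays can be handled as long as `A₂ ∧ B₂` is consistent. -/
theorem exists_loopStep {A B : FmlPair} (hdefs : A.defs.Finite) (hA : A.idxVars.Finite)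
    (hB : B.idxVars.Finite) (hcons : ToEufConsistent A B) {p : ArrTerm × ArrTerm}
    (h1 : p.1 ∈ commonArrs A B) (h2 : p.2 ∈ commonArrs A B) (h3 : p.1 ≠ p.2) :
    ∃ A' B', LoopStep p A B A' B' := by
  classical
  -- Finitely many equalities cannot provide shared diffs at all levels.
  have hex : ∃ k, ¬ CommonDiff A B k p.1 p.2 := by
    by_contra! hall
    choose κ hκ using hall
    refine Set.infinite_of_injective_forall_mem (f := fun k => DefAtom.diff k p.1 p.2 (κ k))
      (fun k l h => by injection h) (fun k => (hκ k).1) hdefs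
  obtain ⟨x, hx⟩ := (hA.union hB).exists_notMem
  exact ⟨_, _, hcons, h1, h2, h3, Nat.find hex, x, Nat.find_spec hex,
    fun l hl => not_not.1 (Nat.find_min hex hl), fun h => hx (.inl h), fun h => hx (.inr h),
    rfl, rfl⟩

theorem LoopRun.length_lt {A B A' B' : FmlPair} {ps : List (ArrTerm × ArrTerm)}
    (hA : A.IsSeparated) (hB : B.IsSeparated) (hAfin : A.IsFinite) (hBfin : B.IsFinite)
    (hAinst : A.IsInstantiated) (hBinst : B.IsInstantiated) (hincons : ¬ ArdConsistent A B)
    (hrun : LoopRun A B ps A' B') (hfair : Fair (commonArrs A B) ps)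
    (hcons : ToEufConsistent A' B') :
    ps.length < ((commonArrs A B).ncard ^ 2 - (commonArrs A B).ncard) / 2 *
      ((A.idxVars ∪ B.idxVars).ncard + 1) := by
  by_contra hlen
  have I := hrun.invariant hAfin hBfin hAinst hBinst
  refine hincons (I.ardConsistent hA hB hAfin hBfin (fun c hc d hd hcd => ?_) hcons)
  have hlt := hfair.lt_timesHandled (finite_commonArrs hAfin) I.handled (not_lt.1 hlen) hc hd hcd
  rw [timesHandled] at hlt
  -- Fairness fixes the order, so one of the two ordered counts vanishes and the other exceeds `n`.
  by_cases hmem : (c, d) ∈ ps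
  · rw [List.count_eq_zero.2 (hfair.1 c d hmem)] at hlt
    exact .inl hlt
  · rw [List.count_eq_zero.2 hmem, Nat.zero_add] at hlt
    exact .inr hlt

end MaxDiff

theorem mainTheorem3 (A B : MaxDiff.FmlPair)
    (hA : A.IsSeparated) (hB : B.IsSeparated)
    (hAfin : A.IsFinite) (hBfin : B.IsFinite)
    (hAinst : A.IsInstantiated) (hBinst : B.IsInstantiated)
    (hincons : ¬ MaxDiff.ArdConsistent A B)
    (n m : ℕ)
    (hn : n = (A.idxVars ∪ B.idxVars).ncard)
    (hm : m = (MaxDiff.commonArrs A B).ncard)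
    (ps : List (MaxDiff.ArrTerm × MaxDiff.ArrTerm)) (A' B' : MaxDiff.FmlPair)
    (hrun : MaxDiff.LoopRun A B ps A' B')
    (hfair : MaxDiff.Fair (MaxDiff.commonArrs A B) ps) :
    ps.length ≤ (m ^ 2 - m) / 2 * (n + 1) ∧
    ((¬ ∃ p A'' B'', MaxDiff.LoopStep p A' B' A'' B'' ∧
        MaxDiff.Fair (MaxDiff.commonArrs A B) (ps ++ [p])) →
      ¬ MaxDiff.ToEufConsistent A' B') := by
  subst hn hm
  have hlt : ∀ {qs A₁ B₁}, MaxDiff.LoopRun A B qs A₁ B₁ →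
      MaxDiff.Fair (MaxDiff.commonArrs A B) qs → MaxDiff.ToEufConsistent A₁ B₁ → _ :=
    MaxDiff.LoopRun.length_lt hA hB hAfin hBfin hAinst hBinst hincons
  refine ⟨?_, fun hend hcons => hend ?_⟩
  · cases hrun with
    | start => exact Nat.zero_le _
    | step p hrun hstep =>
      rw [List.length_append, List.length_singleton]
      -- The last step started from a consistent pair, so the strict bound holds one step earlier.
      exact hlt hrun hfair.of_append hstep.1
  · have I := hrun.invariant hAfin hBfin hAinst hBinst
    -- Consistency makes the bound positive, which forces at least two common arrays and hence a
    -- pair to handle.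
    have hpos := (Nat.zero_le _).trans_lt (hlt hrun hfair hcons)
    have hex : ∃ c ∈ MaxDiff.commonArrs A B, ∃ d ∈ MaxDiff.commonArrs A B, c ≠ d := by
      have hone : 1 < (MaxDiff.commonArrs A B).ncard := by
        by_contra hle
        interval_cases (MaxDiff.commonArrs A B).ncard <;> simp at hpos
      exact (Set.one_lt_ncard (MaxDiff.finite_commonArrs hAfin)).1 hone
    obtain ⟨p, h1, h2, h3, hp⟩ := hfair.exists_extension hex
    rw [← I.common] at h1 h2
    obtain ⟨A'', B'', hs⟩ :=
      MaxDiff.exists_loopStep I.finite_defs I.finiteA I.finiteB hcons h1 h2 h3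
    exact ⟨p, A'', B'', hs, hp⟩
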